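/- \textbf{Setting.} Let $d\ge 1$, $b\ge 2$, $s\ge 0$ be integers. For $j\in\{1,\dots,s\}$ let $\mathcal X^{(j)}\subset\mathbb R^d$ be bounded with volume $1$, and let $\mathcal X=\prod_{j=1}^s\mathcal X^{(j)}\subset\mathbb R^{ds}$. Let each $\mathcal X^{(j)}$ have a recursive split in base $b$: cells $\mathcal X_{j,(k,t)}$ for $k\ge0$, $0\le t<b^k$, with $\mathcal X_{j,(0,0)}=\mathcal X^{(j)}$, such that $\mathcal X_{j,(k,t)}$ is the union of the Borel sets $\mathcal X_{j,(k,t,c)}:=\mathcal X_{j,(k+1,bt+c)}$, $0\le c<b$, each of volume $\mathrm{vol}(\mathcal X_{j,(k,t)})/b$, with pairwise intersections of volume $0$. Suppose that for some $1\le C<\infty$ all cells $\mathcal X_{j,(k,t)}$ have Euclidean diameter at most $Cb^{-k/d}$. For $u\subseteq\{1,\dots,s\}$ let $f_u$ be the ANOVA component of $f:\mathcal X\to\mathbb R$, defined recursively by $f_u(x)=\int_{\mathcal X^{-u}}\bigl(f(x)-\sum_{v\subsetneq u}f_v(x)\bigr)\,dx_{-u}$, where $\mathcal X^{-u}=\prod_{j\notin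 u}\mathcal X^{(j)}$. For tuples $\kappa=(k_j)_{j\in u}$, $\tau=(t_j)_{j\in u}$, $\gamma=(c_j)_{j\in u}$ with $k_j\ge0$, $0\le t_j<b^{k_j}$, $0\le c_j<b$ put $|\kappa|=\sum_{j\in u}k_j$ and $$\psi_{u\kappa\tau\gamma}(x)=\prod_{j\in u}\Bigl(b^{(k_j+1)/2}1_{x_j\in\mathcal X_{j,(k_j,t_j,c_j)}}-b^{(k_j-1)/2}1_{x_j\in\mathcal X_{j,(k_j,t_j)}}\Bigr),\qquad x\in\mathcal X,$$ and $\langle f,g\rangle=\int_{\mathcal X}fg\,dx$. Write $\mathrm{rect}(A)$ for the smallest closed axis-parallel box containing the bounded set $A$, $\mathbb B_{u\kappa\tau}=\prod_{j\in u}\mathcal X_{j,(k_j,t_j)}\prod_{j\notin u}\mathcal X^{(j)}$, and $\widetilde{\mathbb B}_{u\kappa\tau}=\mathrm{rect}(\mathbb B_{u\kappa\tau})$. Let $S_j\subset\{1,\dots,ds\}$ be the set of the $d$ coordinates of the $j$-th factor, $S_u=\bigcup_{j\in u}S_j$, and $\mathbb S_u=\{v\subseteq S_u: v\cap S_j\neq\emptyset\text{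 for all }j\in u\}$. For a set $v$ of coordinates, $\partial^v$ differentiates once with respect to each coordinate in $v$; derivatives of a function on a set are taken within that set, and derivatives of extensions (on $\mathrm{rect}(\mathcal X)$) are taken to be $0$ where they do not exist. Suprema are taken in $[0,\infty]$. \textbf{Statement.} For all $u,\kappa,\tau,\gamma$ as above, the bound $$|\langle f,\psi_{u\kappa\tau\gamma}\rangle|\le\Bigl(2-\frac2b\Bigr)^{|u|}b^{-\frac{|\kappa|}2(1+\frac2d)-\frac{|u|}2}\sum_{v\in\mathbb S_u}d^{|v|/2}C^{|v|}\sup_{y\in\widetilde{\mathbb B}_{u\kappa\tau}}|\partial^v\tilde f_u(y)|\qquad(*)$$ holds in each of the following two cases. (i) $\mathcal X$ is closed with non-empty interior and is Sobol' extensible with some anchor $c\in\mathcal X$, that is, $\mathrm{rect}(\{c,z\})\subseteq\mathcal X$ for all $z\in\mathcal X$; $f$ is smooth on $\mathcal X$, that is, all $\partial^vf$, $v\subseteq\{1,\dots,ds\}$, exist and are continuous on $\mathcal X$; and $\tilde f_u$ is the Sobol' extension of $f_u$, $$\tilde f_u(x)=\sum_{w\subseteq\{1,\dots,ds\}}\int_{[c_w,x_w]}\partial^wf_u(c_{-w}{:}y_w)\,1_{c_{-w}:y_w\in\mathcal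 X}\,dy_w ,$$ where $c_{-w}{:}y_w$ has the coordinates of $y$ in $w$ and those of $c$ outside $w$, and $\int_{[c_w,x_w]}$ is the integral over the box spanned by $c_w$ and $x_w$, with a minus sign if $c_l>x_l$ for an odd number of $l\in w$. (ii) Each $\mathcal X^{(j)}$ is closed with non-empty interior and a boundary of measure zero; $f\in C^{ds}(\mathcal X)$, that is, all partial derivatives of $f$ of total order at most $ds$ exist and are continuous on $\mathcal X$; and $\tilde f_u$ is any Whitney extension of $f_u$, that is, any $\tilde f_u\in C^{ds}(\mathrm{rect}(\mathcal X))$ whose partial derivatives of total order at most $ds$ (including order $0$) agree with those of $f_u$ on $\mathcal X$ and which is analytic on $\mathrm{rect}(\mathcal X)\setminus\mathcal X$. Here $\mathcal X$ need not be Sobol' extensible. -/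

import Mathlib

open MeasureTheory Set
open scoped ENNReal Topology

noncomputable section

/-! ### Splits -/

/-- A `b`-fold split of `A ⊆ ℝ^d` into the Borel sets `P a`, `a ∈ ℤ_b`. -/
structure IsSplit {d : ℕ} (b : ℕ) (A : Set (EuclideanSpace ℝ (Fin d)))
    (P : Fin b → Set (EuclideanSpace ℝ (Fin d))) : Prop where
  borel : ∀ a, MeasurableSet (P a)
  union : A = ⋃ a, P a
  volume_eq : ∀ a, volume (P a) = volume A / (b : ℝ≥0∞)
  overlap : ∀ a a', a ≠ a' → volume (P a ∩ P a') = 0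

/-- A recursive `b`-fold split of `A`.  The cells at level `k` are `cell k t` for `0 ≤ t < b ^ k`;
`cell k t` is split into the cells `cell (k + 1) (b * t + c)`, `c ∈ ℤ_b`. -/
structure RecursiveSplit {d : ℕ} (b : ℕ) (A : Set (EuclideanSpace ℝ (Fin d))) where
  cell : ℕ → ℕ → Set (EuclideanSpace ℝ (Fin d))
  cell_zero : cell 0 0 = A
  isSplit : ∀ k t, t < b ^ k →
    IsSplit b (cell k t) (fun c : Fin b => cell (k + 1) (b * t + (c : ℕ)))

/-! ### Products of regions

A point of `(ℝ^d)^J` is a function `J × Fin d → ℝ`; the coordinate `(j, i)` is the `i`-th coordinate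
of the `j`-th component. -/

/-- The component `x_j ∈ ℝ^d` of `x`. -/
def component {J : Type*} {d : ℕ} (x : J × Fin d → ℝ) (j : J) : EuclideanSpace ℝ (Fin d) :=
  WithLp.toLp 2 (fun i => x (j, i))

/-- The Cartesian product of the sets `X j`, `j ∈ J`. -/
def prodSet {J : Type*} {d : ℕ} (X : J → Set (EuclideanSpace ℝ (Fin d))) : Set (J × Fin d → ℝ) :=
  {x | ∀ j, component x j ∈ X j}

/-- The rectangular hull (bounding box) of a set. -/
def rectHull {ι : Type*} (A : Set (ι → ℝ)) : Set (ι → ℝ) :=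
  {y | ∀ l, y l ∈ Icc (sInf ((fun x : ι → ℝ => x l) '' A)) (sSup ((fun x : ι → ℝ => x l) '' A))}

/-! ### ANOVA -/

/-- The point whose components are those of `x` for `j ∈ u` and those of `y` for `j ∉ u`. -/
def glue {s d : ℕ} (u : Finset (Fin s)) (x : Fin s × Fin d → ℝ)
    (y : {j : Fin s // j ∉ u} × Fin d → ℝ) : Fin s × Fin d → ℝ :=
  fun p => if h : p.1 ∈ u then x p else y (⟨p.1, h⟩, p.2)

/-- `∫_{X^{-u}} g(x) dx_{-u}`, as a function of `x` (it depends on `x_u` only). -/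
def integralOut {s d : ℕ} (X : Fin s → Set (EuclideanSpace ℝ (Fin d))) (u : Finset (Fin s))
    (g : (Fin s × Fin d → ℝ) → ℝ) (x : Fin s × Fin d → ℝ) : ℝ :=
  ∫ y in prodSet (fun j : {j : Fin s // j ∉ u} => X j.1), g (glue u x y)

/-- The ANOVA component `f_u = ∫_{X^{-u}} (f - ∑_{v ⊊ u} f_v) dx_{-u}`. -/
def anova {s d : ℕ} (X : Fin s → Set (EuclideanSpace ℝ (Fin d)))
    (f : (Fin s × Fin d → ℝ) → ℝ) (u : Finset (Fin s)) : (Fin s × Fin d → ℝ) → ℝ :=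
  integralOut X u (fun x => f x - ∑ v ∈ u.ssubsets.attach, anova X f v.1 x)
termination_by u.card
decreasing_by exact Finset.card_lt_card (Finset.mem_ssubsets.1 v.2)

/-! ### Multiresolution -/

/-- The univariate basis function
`ψ_{ktc} = b^{(k+1)/2} 1_{X_{(k,t,c)}} - b^{(k-1)/2} 1_{X_{(k,t)}}`. -/
def haar {d b : ℕ} {A : Set (EuclideanSpace ℝ (Fin d))} (S : RecursiveSplit b A) (k t c : ℕ)
    (x : EuclideanSpace ℝ (Fin d)) : ℝ :=
  (b : ℝ) ^ (((k : ℝ) + 1) / 2) * (S.cell (k + 1) (b * t + c)).indicator 1 x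
    - (b : ℝ) ^ (((k : ℝ) - 1) / 2) * (S.cell k t).indicator 1 x

/-- The basis function `ψ_{uκτγ}(x) = ∏_{j ∈ u} ψ_{j k_j t_j c_j}(x_j) ∏_{j ∉ u} φ_j(x_j)`, where
`φ_j = 1` on `X j`. -/
def multiHaar {s d b : ℕ} {X : Fin s → Set (EuclideanSpace ℝ (Fin d))}
    (S : ∀ j, RecursiveSplit b (X j)) (u : Finset (Fin s)) (κ : u → ℕ)
    (τ : ∀ j : u, Fin (b ^ κ j)) (γ : u → Fin b) (x : Fin s × Fin d → ℝ) : ℝ :=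
  (∏ j : u, haar (S j.1) (κ j) (τ j) (γ j) (component x j.1)) *
    ∏ j ∈ uᶜ, (X j).indicator 1 (component x j)

/-- The inner product `⟨f, g⟩` of `L²` of the product of the sets `X j`. -/
def innerProd {s d : ℕ} (X : Fin s → Set (EuclideanSpace ℝ (Fin d)))
    (f g : (Fin s × Fin d → ℝ) → ℝ) : ℝ :=
  ∫ x in prodSet X, f x * g x

/-- `B_{uκτ} = ∏_{j ∈ u} X_{j,(k_j,t_j)} ∏_{j ∉ u} X^{(j)}`. -/
def cellProd {s d b : ℕ} {X : Fin s → Set (EuclideanSpace ℝ (Fin d))}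
    (S : ∀ j, RecursiveSplit b (X j)) (u : Finset (Fin s)) (κ : u → ℕ)
    (τ : ∀ j : u, Fin (b ^ κ j)) : Set (Fin s × Fin d → ℝ) :=
  prodSet (fun j => if h : j ∈ u then (S j).cell (κ ⟨j, h⟩) (τ ⟨j, h⟩) else X j)

/-! ### Partial derivatives -/

/-- The values of the coordinate `l` for which the point `x`, with its other coordinates kept,
is in `D`. -/
def slice {ι : Type*} [DecidableEq ι] (D : Set (ι → ℝ)) (x : ι → ℝ) (l : ι) : Set ℝ :=
  {r | Function.update x l r ∈ D}

/-- `h x a` : `a` is the partial derivative at `x`, with respect to the coordinate `l`, of the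
function `g` on `D` (one-sided where `D` lies on one side only). -/
def HasPartialWithinAt {ι : Type*} [DecidableEq ι] (D : Set (ι → ℝ)) (g : (ι → ℝ) → ℝ) (l : ι)
    (x : ι → ℝ) (a : ℝ) : Prop :=
  HasDerivWithinAt (fun r => g (Function.update x l r)) a (slice D x l) (x l)

/-- The partial derivative of the function `g` on `D`, and `0` where it does not exist. -/
def partialWithin {ι : Type*} [DecidableEq ι] (D : Set (ι → ℝ)) (l : ι) (g : (ι → ℝ) → ℝ)
    (x : ι → ℝ) : ℝ :=
  derivWithin (fun r => g (Function.update x l r)) (slice D x l) (x l)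

/-- The mixed partial derivative `∂^v g` of the function `g` on `D`, once with respect to each
coordinate in `v`; partial derivatives are `0` where they do not exist. -/
def mixedPartial {s d : ℕ} (D : Set (Fin s × Fin d → ℝ)) (g : (Fin s × Fin d → ℝ) → ℝ)
    (v : Finset (Fin s × Fin d)) : (Fin s × Fin d → ℝ) → ℝ :=
  ((List.finRange s ×ˢ List.finRange d).filter (· ∈ v)).foldr (fun l h => partialWithin D l h) g

/-- `g` is smooth on `D`: the mixed partial derivatives `∂^v g = F v`, for all sets `v` of
coordinates, exist and are continuous on `D`. -/
def SmoothOn {ι : Type*} [DecidableEq ι] (D : Set (ι → ℝ)) (g : (ι → ℝ) → ℝ) : Prop :=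
  ∃ F : Finset ι → (ι → ℝ) → ℝ, EqOn (F ∅) g D ∧ (∀ v, ContinuousOn (F v) D) ∧
    ∀ v, ∀ l ∉ v, ∀ x ∈ D, HasPartialWithinAt D (F v) l x (F (insert l v) x)

/-- The functions `G k`, `|k| ≤ m`, are the partial derivatives `D_k g` of `g` on `D` up to total
order `m`, and they are continuous on `D`. -/
def HasPartialsUpTo {ι : Type*} [Fintype ι] [DecidableEq ι] (D : Set (ι → ℝ)) (m : ℕ)
    (g : (ι → ℝ) → ℝ) (G : (ι → ℕ) → (ι → ℝ) → ℝ) : Prop :=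
  EqOn (G 0) g D ∧ (∀ k, ∑ i, k i ≤ m → ContinuousOn (G k) D) ∧
    ∀ k l, ∑ i, k i < m → ∀ x ∈ D, HasPartialWithinAt D (G k) l x (G (k + Pi.single l 1) x)

/-- `g ∈ C^m(D)`. -/
def InCm {ι : Type*} [Fintype ι] [DecidableEq ι] (D : Set (ι → ℝ)) (m : ℕ)
    (g : (ι → ℝ) → ℝ) : Prop :=
  ∃ G, HasPartialsUpTo D m g G

/-! ### Extensions -/

/-- The closed set `D`, with non-empty interior, is Sobol' extensible with anchor `c`.  Here
`uIcc c z` is the closed box spanned by `c` and `z`. -/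
structure IsSobolExtensible {ι : Type*} (D : Set (ι → ℝ)) (c : ι → ℝ) : Prop where
  isClosed : IsClosed D
  interior_nonempty : (interior D).Nonempty
  anchor_mem : c ∈ D
  box_subset : ∀ z ∈ D, uIcc c z ⊆ D

/-- The hybrid point `c_{-w} : y_w`. -/
def hybrid {ι : Type*} [DecidableEq ι] (c : ι → ℝ) (w : Finset ι) (y : w → ℝ) : ι → ℝ :=
  fun l => if h : l ∈ w then y ⟨l, h⟩ else c l

/-- `∫_{[c_w, x_w]} h(y_w) dy_w`: the integral over the box spanned by `c_w` and `x_w`, with a minus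
sign if `c_l > x_l` for an odd number of `l ∈ w`. -/
def signedBoxIntegral {ι : Type*} (w : Finset ι) (c x : ι → ℝ) (h : (w → ℝ) → ℝ) : ℝ :=
  (∏ l ∈ w, if x l < c l then (-1 : ℝ) else 1) *
    ∫ y in uIcc (fun l : w => c l.1) (fun l : w => x l.1), h y

/-- The Sobol' extension
`g̃(x) = ∑_w ∫_{[c_w, x_w]} ∂^w g(c_{-w} : y_w) 1_{c_{-w} : y_w ∈ D} dy_w`. -/
def sobolExtension {s d : ℕ} (D : Set (Fin s × Fin d → ℝ)) (c : Fin s × Fin d → ℝ)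
    (g : (Fin s × Fin d → ℝ) → ℝ) (x : Fin s × Fin d → ℝ) : ℝ :=
  ∑ w : Finset (Fin s × Fin d),
    signedBoxIntegral w c x (fun y => D.indicator (mixedPartial D g w) (hybrid c w y))

/-- `e` is a Whitney extension of `g ∈ C^m(D)`: it is in `C^m(rect(D))`, it has the same partial
derivatives as `g` on `D` up to total order `m` (including order `0`, so that `e = g` on `D`), and
it is analytic on `rect(D) \ D`. -/
def IsWhitneyExtension {ι : Type*} [Fintype ι] [DecidableEq ι] (D : Set (ι → ℝ)) (m : ℕ)
    (g e : (ι → ℝ) → ℝ) : Prop :=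
  (∃ G E, HasPartialsUpTo D m g G ∧ HasPartialsUpTo (rectHull D) m e E ∧
    ∀ k, ∑ i, k i ≤ m → EqOn (E k) (G k) D) ∧
  AnalyticOn ℝ e (rectHull D \ D)

/-! ### The bound -/

/-- The sets `T ⊆ S_u` of coordinates that meet `S_j` for every `j ∈ u`, where `S_j` is the set of
the coordinates of the `j`-th component and `S_u` is the union of the `S_j`, `j ∈ u`. -/
def touching {s : ℕ} (d : ℕ) (u : Finset (Fin s)) : Finset (Finset (Fin s × Fin d)) :=
  (u ×ˢ Finset.univ).powerset.filter
    (fun T => ∀ j ∈ u, (T ∩ ({j} ×ˢ Finset.univ)).Nonempty)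

/-- The right-hand side
`(2 - 2/b)^{|u|} b^{-(|κ|/2)(1 + 2/d) - |u|/2} ∑_v d^{|v|/2} C^{|v|} sup_{rect(B_{uκτ})} |∂^v e|`
for a function `e` on `rect(X^{1:s})`; the sum is over the `v` in `touching d u` and the suprema are
taken in `[0, ∞]`. -/
def coefficientBound {s d b : ℕ} {X : Fin s → Set (EuclideanSpace ℝ (Fin d))}
    (S : ∀ j, RecursiveSplit b (X j)) (C : ℝ) (u : Finset (Fin s)) (κ : u → ℕ)
    (τ : ∀ j : u, Fin (b ^ κ j)) (e : (Fin s × Fin d → ℝ) → ℝ) : ℝ≥0∞ :=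
  ENNReal.ofReal ((2 - 2 / (b : ℝ)) ^ u.card *
      (b : ℝ) ^ (-(((∑ j, κ j : ℕ) : ℝ) / 2 * (1 + 2 / (d : ℝ))) - (u.card : ℝ) / 2)) *
    ∑ v ∈ touching d u, ENNReal.ofReal ((d : ℝ) ^ ((v.card : ℝ) / 2) * C ^ v.card) *
      ⨆ y ∈ rectHull (cellProd S u κ τ),
        ENNReal.ofReal |mixedPartial (rectHull (prodSet X)) e v y|

end

set_option linter.unusedSectionVars false

noncomputable section

theorem abs_intervalIntegral_le {p q M : ℝ} {h : ℝ → ℝ}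
    (hM : ∀ᵐ r, r ∈ uIoc p q → |h r| ≤ M) : |∫ r in p..q, h r| ≤ M * |q - p| :=
  intervalIntegral.norm_integral_le_of_norm_le_const_ae (f := h) hM

/-! ### Lebesgue differentiation with parameters -/

theorem ae_forall_hasDerivAt_integral {K : Type*} [PseudoMetricSpace K]
    [SecondCountableTopology K] (φ : K → ℝ → ℝ) (Λ : ℝ)
    (hΛ : ∀ k k' r, |φ k r - φ k' r| ≤ Λ * dist k k')
    (hφ : ∀ k, LocallyIntegrable (φ k) volume) (c : ℝ) :
    ∀ᵐ r, ∀ k, HasDerivAt (fun t => ∫ x in c..t, φ k x) (φ k r) r := by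
  obtain ⟨Q, hQc, hQd⟩ := TopologicalSpace.exists_countable_dense K
  have h1 : ∀ᵐ r, ∀ k ∈ Q, HasDerivAt (fun t => ∫ x in c..t, φ k x) (φ k r) r := by
    rw [ae_ball_iff hQc]
    intro k _
    filter_upwards [LocallyIntegrable.ae_hasDerivAt_integral (hφ k)] with r hr using hr c
  have hint : ∀ k a b, IntervalIntegrable (φ k) volume a b := fun k a b =>
    ((hφ k).integrableOn_isCompact isCompact_uIcc).intervalIntegrable
  filter_upwards [h1] with r hr k
  rw [hasDerivAt_iff_isLittleO, Asymptotics.isLittleO_iff]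
  intro ε hε
  obtain ⟨k', hk', hkk⟩ : ∃ k' ∈ Q, dist k k' < ε / (3 * (|Λ| + 1)) :=
    Metric.mem_closure_iff.1 (hQd k) _ (by positivity)
  have hclose : ∀ x, |φ k x - φ k' x| ≤ ε / 3 := by
    intro x
    have h2 : 0 < |Λ| + 1 := by positivity
    have h3 : dist k k' * (3 * (|Λ| + 1)) < ε := (lt_div_iff₀ (by positivity)).1 hkk
    have h4 : Λ * dist k k' ≤ |Λ| * dist k k' :=
      mul_le_mul_of_nonneg_right (le_abs_self Λ) dist_nonneg
    have h5 := hΛ k k' x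
    nlinarith [dist_nonneg (x := k) (y := k')]
  have h2 := (hasDerivAt_iff_isLittleO.1 (hr k' hk'))
  rw [Asymptotics.isLittleO_iff] at h2
  filter_upwards [h2 (show 0 < ε / 3 by positivity)] with t ht
  have e1 : ∀ k, (∫ x in c..t, φ k x) - (∫ x in c..r, φ k x) = ∫ x in r..t, φ k x := fun k =>
    intervalIntegral.integral_interval_sub_left (hint k _ _) (hint k _ _)
  simp only [e1, Real.norm_eq_abs, smul_eq_mul] at ht ⊢
  have e2 : |(∫ x in r..t, φ k x) - ∫ x in r..t, φ k' x| ≤ ε / 3 * |t - r| := by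
    rw [← intervalIntegral.integral_sub (hint k _ _) (hint k' _ _)]
    exact abs_intervalIntegral_le (Filter.Eventually.of_forall fun x _ => hclose x)
  have e3 : |(t - r) * φ k r - (t - r) * φ k' r| ≤ ε / 3 * |t - r| := by
    rw [← mul_sub, abs_mul, mul_comm]
    exact mul_le_mul_of_nonneg_right (hclose r) (abs_nonneg _)
  rw [abs_le] at *
  constructor <;> linarith [ht.1, ht.2, e2.1, e2.2, e3.1, e3.2]

/-! ### Families of weak mixed derivatives on a box -/

section Family

variable {ι : Type*} [Fintype ι] [DecidableEq ι]

/-- `G P`, for `P ⊆ ι`, is the weak mixed derivative `∂^P` of `G ∅` on the box `Icc a b`, in the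
sense that `G P` is on each segment parallel to the axis `l ∉ P` a primitive of
`G (insert l P)`. -/
structure WeakMixedFamily (a b : ι → ℝ) (G : Finset ι → (ι → ℝ) → ℝ) : Prop where
  measurable : ∀ P, Measurable (G P)
  bounded : ∃ M, ∀ P x, |G P x| ≤ M
  zero : ∀ P, ∀ x ∉ Icc a b, G P x = 0
  sub_eq : ∀ P, ∀ l ∉ P, ∀ x ∈ Icc a b, ∀ z ∈ Icc (a l) (b l),
    G P x - G P (Function.update x l z) = ∫ r in z..x l, G (insert l P) (Function.update x l r)

theorem update_mem_Icc {a b x : ι → ℝ} (hx : x ∈ Icc a b) {l : ι} {r : ℝ}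
    (hr : r ∈ Icc (a l) (b l)) : Function.update x l r ∈ Icc a b := by
  refine ⟨fun m => ?_, fun m => ?_⟩ <;> by_cases h : m = l
  · subst h; simpa using hr.1
  · simpa [h] using hx.1 m
  · subst h; simpa using hr.2
  · simpa [h] using hx.2 m

theorem mem_Icc_of_update_mem {a b x : ι → ℝ} {l : ι} {r : ℝ}
    (h : Function.update x l r ∈ Icc a b) : r ∈ Icc (a l) (b l) := by
  have h1 := h.1 l
  have h2 := h.2 l
  simp at h1 h2
  exact ⟨h1, h2⟩

namespace WeakMixedFamily

variable {a b : ι → ℝ} {G : Finset ι → (ι → ℝ) → ℝ}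

theorem lipschitz_aux (hG : WeakMixedFamily a b G) {M : ℝ} (hM : ∀ P x, |G P x| ≤ M)
    (P : Finset ι) {y y' : ι → ℝ} (hy : y ∈ Icc a b) (hy' : y' ∈ Icc a b) (T : Finset ι)
    (hT : Disjoint T P) :
    |G P y - G P (T.piecewise y' y)| ≤ M * ∑ m ∈ T, |y m - y' m| := by
  induction T using Finset.induction_on with
  | empty => simp
  | insert m T hm ih =>
    rw [Finset.disjoint_insert_left] at hT
    have h1 := ih hT.2
    rw [Finset.piecewise_insert, Finset.sum_insert hm]
    set w := T.piecewise y' y with hw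
    have hwm : w m = y m := by simp [hw, hm]
    have hwD : w ∈ Icc a b := by
      refine ⟨fun i => ?_, fun i => ?_⟩ <;> by_cases h : i ∈ T <;> simp [hw, h]
      · exact hy'.1 i
      · exact hy.1 i
      · exact hy'.2 i
      · exact hy.2 i
    have h2 := hG.sub_eq P m hT.1 w hwD (y' m) ⟨hy'.1 m, hy'.2 m⟩
    have h3 : |G P w - G P (Function.update w m (y' m))| ≤ M * |y m - y' m| := by
      rw [h2, ← hwm]
      exact abs_intervalIntegral_le (Filter.Eventually.of_forall fun r _ => hM _ _)
    calc |G P y - G P (Function.update w m (y' m))|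
        ≤ |G P y - G P w| + |G P w - G P (Function.update w m (y' m))| := abs_sub_le _ _ _
      _ ≤ _ := by rw [mul_add]; linarith

theorem lipschitz (hG : WeakMixedFamily a b G) {M : ℝ} (hM : ∀ P x, |G P x| ≤ M)
    (P : Finset ι) {y y' : ι → ℝ} (hy : y ∈ Icc a b) (hy' : y' ∈ Icc a b)
    (hP : ∀ m ∈ P, y m = y' m) :
    |G P y - G P y'| ≤ M * Fintype.card ι * dist y y' := by
  have h := hG.lipschitz_aux hM P hy hy' Pᶜ disjoint_compl_left
  have h0 : 0 ≤ M := (abs_nonneg _).trans (hM P y)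
  have e : Pᶜ.piecewise y' y = y' := by
    ext m
    by_cases hm : m ∈ P <;> simp [hm, hP]
  rw [e] at h
  refine h.trans ?_
  rw [mul_assoc]
  refine mul_le_mul_of_nonneg_left ?_ h0
  calc ∑ m ∈ Pᶜ, |y m - y' m| ≤ ∑ m ∈ Pᶜ, dist y y' :=
        Finset.sum_le_sum fun m _ => by
          rw [← Real.dist_eq]; exact dist_le_pi_dist y y' m
    _ = (Pᶜ.card : ℝ) * dist y y' := by simp
    _ ≤ _ := mul_le_mul_of_nonneg_right (by exact_mod_cast Finset.card_le_univ _) dist_nonneg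

theorem ae_hasDerivAt (hG : WeakMixedFamily a b G) (P : Finset ι) (l : ι) (hl : l ∉ P)
    (y₀ : ι → ℝ) :
    ∀ᵐ r, r ∈ Ioo (a l) (b l) → ∀ y ∈ Icc a b, (∀ m ∈ P, y m = y₀ m) →
      HasDerivAt (fun t => G P (Function.update y l t))
        (G (insert l P) (Function.update y l r)) r := by
  obtain ⟨M, hM⟩ := hG.bounded
  let K := {y : ι → ℝ // y ∈ Icc a b ∧ ∀ m ∈ P, y m = y₀ m}
  let φ : K → ℝ → ℝ := fun k r => G (insert l P) (Function.update k.1 l r)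
  have hmeas : ∀ k, Measurable (φ k) := fun k =>
    (hG.measurable _).comp (measurable_update k.1)
  have h := ae_forall_hasDerivAt_integral φ (M * Fintype.card ι) (by
    intro k k' r
    have h0 : 0 ≤ M := (abs_nonneg _).trans (hM P y₀)
    have hd : dist (Function.update k.1 l r) (Function.update k'.1 l r) ≤ dist k k' := by
      rw [dist_pi_le_iff dist_nonneg]
      intro m
      by_cases hm : m = l
      · subst hm; simp
      · rw [Function.update_of_ne hm, Function.update_of_ne hm]
        exact dist_le_pi_dist k.1 k'.1 m
    by_cases hr : r ∈ Icc (a l) (b l)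
    · refine (hG.lipschitz hM _ (update_mem_Icc k.2.1 hr) (update_mem_Icc k'.2.1 hr)
        ?_).trans (mul_le_mul_of_nonneg_left hd (by positivity))
      intro m hm
      by_cases h : m = l
      · subst h; simp
      · have : m ∈ P := Finset.mem_of_mem_insert_of_ne hm h
        simp [h, k.2.2 m this, k'.2.2 m this]
    · simp only [φ]
      rw [hG.zero _ _ (fun h => hr (mem_Icc_of_update_mem h)),
        hG.zero _ _ (fun h => hr (mem_Icc_of_update_mem h))]
      simp only [sub_self, abs_zero]
      positivity) (by
    intro k
    exact (locallyIntegrable_const M).mono (hmeas k).aestronglyMeasurable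
      (Filter.Eventually.of_forall fun r => (hM _ _).trans (le_abs_self M))) (a l)
  filter_upwards [h] with r hr hrI y hy hyP
  have h1 := hr ⟨y, hy, hyP⟩
  have h2 : (fun t => G P (Function.update y l t)) =ᶠ[𝓝 r]
      fun t => (∫ x in a l..t, φ ⟨y, hy, hyP⟩ x) + G P (Function.update y l (a l)) := by
    filter_upwards [Icc_mem_nhds hrI.1 hrI.2] with t ht
    have h3 := hG.sub_eq P l hl _ (update_mem_Icc hy ht) (a l)
      ⟨le_rfl, hrI.1.le.trans hrI.2.le⟩
    simp only [Function.update_idem, Function.update_self] at h3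
    simp only [φ]
    linarith
  exact (h1.add_const _).congr_of_eventuallyEq h2

end WeakMixedFamily

/-! ### Mean value inequality for mixed differences -/

/-- The difference `g(y) - g(y[l := z_l])`. -/
def coordDiff (z : ι → ℝ) (l : ι) (g : (ι → ℝ) → ℝ) (y : ι → ℝ) : ℝ :=
  g y - g (Function.update y l (z l))

/-- The mixed difference along the coordinates in the list `L`. -/
def mixedDiff (z : ι → ℝ) (L : List ι) (g : (ι → ℝ) → ℝ) : (ι → ℝ) → ℝ :=
  L.foldr (fun l h => coordDiff z l h) g

theorem mixedDiff_cons (z : ι → ℝ) (l : ι) (L : List ι) (g : (ι → ℝ) → ℝ) (y : ι → ℝ) :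
    mixedDiff z (l :: L) g y =
      mixedDiff z L g y - mixedDiff z L g (Function.update y l (z l)) := rfl

theorem mixedDiff_congr {a b z : ι → ℝ} (hz : z ∈ Icc a b) (L : List ι) {g h : (ι → ℝ) → ℝ}
    {y : ι → ℝ} (hy : y ∈ Icc a b)
    (hgh : ∀ y' ∈ Icc a b, (∀ m ∉ L, y' m = y m) → g y' = h y') :
    mixedDiff z L g y = mixedDiff z L h y := by
  induction L generalizing y with
  | nil => exact hgh y hy fun _ _ => rfl
  | cons l L ih =>
    rw [mixedDiff_cons, mixedDiff_cons, ih hy, ih (update_mem_Icc hy ⟨hz.1 l, hz.2 l⟩)]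
    · intro y' hy' h'
      refine hgh y' hy' fun m hm => ?_
      rw [List.mem_cons, not_or] at hm
      rw [h' m hm.2, Function.update_of_ne hm.1]
    · intro y' hy' h'
      exact hgh y' hy' fun m hm => h' m (fun h => hm (List.mem_cons_of_mem _ h))

theorem mixedDiff_measurable (z : ι → ℝ) (L : List ι) {g : (ι → ℝ) → ℝ} (hg : Measurable g) :
    Measurable (mixedDiff z L g) := by
  induction L with
  | nil => exact hg
  | cons l L ih =>
    exact ih.sub (ih.comp (measurable_update' (a := l) |>.comp
      (measurable_id.prodMk measurable_const)))

theorem mixedDiff_bounded (z : ι → ℝ) (L : List ι) {g : (ι → ℝ) → ℝ}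
    (hg : ∃ M, ∀ x, |g x| ≤ M) : ∃ M, ∀ x, |mixedDiff z L g x| ≤ M := by
  induction L with
  | nil => exact hg
  | cons l L ih =>
    obtain ⟨M, hM⟩ := ih
    exact ⟨M + M, fun x => (abs_sub _ _).trans (add_le_add (hM _) (hM _))⟩

theorem intervalIntegrable_of_bounded {h : ℝ → ℝ} (hm : Measurable h) {M : ℝ}
    (hM : ∀ r, |h r| ≤ M) (p q : ℝ) : IntervalIntegrable h volume p q :=
  (intervalIntegrable_const (c := M)).mono_fun hm.aestronglyMeasurable
    (Filter.Eventually.of_forall fun r => (hM r).trans (le_abs_self M))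

theorem mixedDiff_integral (z : ι → ℝ) (L : List ι) (l : ι) (hl : l ∉ L) {H : (ι → ℝ) → ℝ}
    (hH : Measurable H) (hb : ∃ M, ∀ x, |H x| ≤ M) (y : ι → ℝ) :
    mixedDiff z L (fun y => ∫ r in z l..y l, H (Function.update y l r)) y =
      ∫ r in z l..y l, mixedDiff z L H (Function.update y l r) := by
  induction L generalizing y with
  | nil => rfl
  | cons m L ih =>
    rw [List.mem_cons, not_or] at hl
    rw [mixedDiff_cons, ih hl.2, ih hl.2, Function.update_of_ne hl.1,
      ← intervalIntegral.integral_sub]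
    · simp_rw [mixedDiff_cons, Function.update_comm hl.1]
    all_goals
      obtain ⟨M, hM⟩ := mixedDiff_bounded z L hb
      exact intervalIntegrable_of_bounded
        ((mixedDiff_measurable z L hH).comp (measurable_update _)) (fun r => hM _) _ _

theorem slice_Icc {a b x : ι → ℝ} (hx : x ∈ Icc a b) (l : ι) :
    slice (Icc a b) x l = Icc (a l) (b l) :=
  Set.ext fun _ => ⟨mem_Icc_of_update_mem, update_mem_Icc hx⟩

theorem WeakMixedFamily.abs_mixedDiff_le {a b : ι → ℝ} {G : Finset ι → (ι → ℝ) → ℝ}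
    (hG : WeakMixedFamily a b G) {z : ι → ℝ} (hz : z ∈ Icc a b) (L : List ι) (hL : L.Nodup)
    (P : Finset ι) (hLP : ∀ l ∈ L, l ∉ P) (g : (ι → ℝ) → ℝ) {y : ι → ℝ} (hy : y ∈ Icc a b)
    (hg : ∀ y' ∈ Icc a b, (∀ m ∉ L, y' m = y m) → g y' = G P y') (M : ℝ)
    (hM : ∀ y' ∈ Icc a b, (∀ m ∉ L, y' m = y m) → (∀ m ∈ L, y' m ∈ uIcc (z m) (y m)) →
      |L.foldr (fun l h => partialWithin (Icc a b) l h) g y'| ≤ M) :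
    |mixedDiff z L g y| ≤ M * (L.map fun l => |y l - z l|).prod := by
  induction L using List.reverseRecOn generalizing P g y with
  | nil => simpa [mixedDiff] using hM y hy (fun _ _ => rfl) (by simp)
  | append_singleton L l ih =>
    have hlL : l ∉ L := fun h => by
      have := List.nodup_append.1 hL
      exact this.2.2 l h l (by simp) rfl
    have hLn : L.Nodup := (List.nodup_append.1 hL).1
    have hlP : l ∉ P := hLP l (by simp)
    have e1 : mixedDiff z (L ++ [l]) g y = mixedDiff z L (coordDiff z l g) y := by
      simp [mixedDiff]
    have e2 : mixedDiff z L (coordDiff z l g) y =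
        ∫ r in z l..y l, mixedDiff z L (G (insert l P)) (Function.update y l r) := by
      rw [← mixedDiff_integral z L l hlL (hG.measurable _)
        (hG.bounded.imp fun M h x => h _ x) y]
      refine mixedDiff_congr hz L hy fun y' hy' h' => ?_
      have hzl : z l ∈ Icc (a l) (b l) := ⟨hz.1 l, hz.2 l⟩
      rw [← hG.sub_eq P l hlP y' hy' _ hzl, coordDiff, hg y' hy', hg _ (update_mem_Icc hy' hzl)]
      · intro m hm
        simp only [List.mem_append, List.mem_singleton, not_or] at hm
        rw [Function.update_of_ne hm.2, h' m hm.1]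
      · intro m hm
        simp only [List.mem_append, List.mem_singleton, not_or] at hm
        exact h' m hm.1
    rw [e1, e2]
    have e3 : M * ((L ++ [l]).map fun l => |y l - z l|).prod =
        M * (L.map fun l => |y l - z l|).prod * |y l - z l| := by
      simp [mul_assoc]
    rw [e3]
    refine abs_intervalIntegral_le ?_
    have hends : ∀ᵐ r : ℝ, r ≠ a l ∧ r ≠ b l :=
      (Measure.ae_ne volume (a l)).and (Measure.ae_ne volume (b l))
    filter_upwards [hG.ae_hasDerivAt P l hlP y, hends] with r hr hne hrI
    have hru : r ∈ uIcc (z l) (y l) := uIoc_subset_uIcc hrI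
    have hrD : r ∈ Icc (a l) (b l) :=
      uIcc_subset_Icc ⟨hz.1 l, hz.2 l⟩ ⟨hy.1 l, hy.2 l⟩ hru
    have hrO : r ∈ Ioo (a l) (b l) :=
      ⟨lt_of_le_of_ne hrD.1 hne.1.symm, lt_of_le_of_ne hrD.2 hne.2⟩
    have hyr := update_mem_Icc hy hrD
    have hpart : ∀ y' ∈ Icc a b, (∀ m ∉ L, y' m = Function.update y l r m) →
        partialWithin (Icc a b) l g y' = G (insert l P) y' := by
      intro y' hy' h'
      have hy'l : y' l = r := by rw [h' l hlL, Function.update_self]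
      have hoff : ∀ m ∉ L ++ [l], y' m = y m := fun m hm => by
        simp only [List.mem_append, List.mem_singleton, not_or] at hm
        rw [h' m hm.1, Function.update_of_ne hm.2]
      have hd := hr hrO y' hy' fun m hm => hoff m fun hmL => hLP m hmL hm
      rw [partialWithin, slice_Icc hy', hy'l]
      have h1 := (hd.hasDerivWithinAt (s := Icc (a l) (b l))).congr_of_mem
        (f₁ := fun r => g (Function.update y' l r)) (fun t ht => by
          refine hg _ (update_mem_Icc hy' ht) fun m hm => ?_
          rw [← hoff m hm, Function.update_of_ne]
          rintro rfl
          exact hm (by simp)) hrD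
      rw [h1.derivWithin (uniqueDiffOn_Icc (hrO.1.trans hrO.2) r hrD), ← hy'l,
        Function.update_eq_self]
    have h2 := ih hLn (insert l P) (fun m hm => by
        rw [Finset.mem_insert, not_or]
        exact ⟨fun h => hlL (h ▸ hm), hLP m (by simp [hm])⟩)
      (partialWithin (Icc a b) l g) hyr hpart (by
        intro y' hy' h' hbox
        have h3 := hM y' hy' (fun m hm => by
            simp only [List.mem_append, List.mem_singleton, not_or] at hm
            rw [h' m hm.1, Function.update_of_ne hm.2]) (fun m hm => by
            simp only [List.mem_append, List.mem_singleton] at hm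
            by_cases hml : m = l
            · subst hml
              rw [h' m hlL, Function.update_self]
              exact hru
            · simpa [hml] using hbox m (hm.resolve_right hml))
        simpa using h3)
    rw [mixedDiff_congr hz L hyr hpart] at h2
    refine h2.trans (le_of_eq ?_)
    congr 2
    refine List.map_congr_left fun m hm => ?_
    rw [Function.update_of_ne]
    rintro rfl
    exact hlL hm

end Family

/-! ### Differences along blocks of coordinates -/

section Block

variable {s d : ℕ}

/-- The point `y` with its `j`-th component replaced by that of `z`. -/
def replaceBlock (z : Fin s × Fin d → ℝ) (j : Fin s) (y : Fin s × Fin d → ℝ) :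
    Fin s × Fin d → ℝ :=
  fun p => if p.1 = j then z p else y p

/-- The point `y` with the first `k` coordinates of its `j`-th component replaced by those
of `z`. -/
def replaceInit (z : Fin s × Fin d → ℝ) (j : Fin s) (k : ℕ) (y : Fin s × Fin d → ℝ) :
    Fin s × Fin d → ℝ :=
  fun p => if p.1 = j ∧ p.2.1 < k then z p else y p

theorem replaceInit_zero (z : Fin s × Fin d → ℝ) (j : Fin s) (y : Fin s × Fin d → ℝ) :
    replaceInit z j 0 y = y := by
  ext p; simp [replaceInit]

theorem replaceInit_last (z : Fin s × Fin d → ℝ) (j : Fin s) (y : Fin s × Fin d → ℝ) :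
    replaceInit z j d y = replaceBlock z j y := by
  ext p; simp [replaceInit, replaceBlock]

theorem replaceInit_succ (z : Fin s × Fin d → ℝ) (j : Fin s) (i : Fin d)
    (y : Fin s × Fin d → ℝ) :
    replaceInit z j (i.1 + 1) y = Function.update (replaceInit z j i.1 y) (j, i) (z (j, i)) := by
  ext ⟨j', i'⟩
  by_cases h : (j', i') = (j, i)
  · rw [h]; simp [replaceInit]
  · rw [Function.update_of_ne h]
    rw [Prod.mk.injEq, not_and, Fin.ext_iff] at h
    simp only [replaceInit]
    congr 1
    refine propext (and_congr_right fun hj => ?_)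
    have := h (by rw [hj])
    omega

/-- The difference `g(y) - g(y with its j-th component replaced by that of z)`. -/
def blockDiff (z : Fin s × Fin d → ℝ) (j : Fin s) (g : (Fin s × Fin d → ℝ) → ℝ)
    (y : Fin s × Fin d → ℝ) : ℝ :=
  g y - g (replaceBlock z j y)

/-- The mixed difference along the blocks in the list `L`. -/
def blockDiffs (z : Fin s × Fin d → ℝ) (L : List (Fin s)) (g : (Fin s × Fin d → ℝ) → ℝ) :
    (Fin s × Fin d → ℝ) → ℝ :=
  L.foldr (fun j h => blockDiff z j h) g

theorem blockDiffs_cons (z : Fin s × Fin d → ℝ) (j : Fin s) (L : List (Fin s))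
    (g : (Fin s × Fin d → ℝ) → ℝ) (y : Fin s × Fin d → ℝ) :
    blockDiffs z (j :: L) g y =
      blockDiffs z L g y - blockDiffs z L g (replaceBlock z j y) := rfl

theorem blockDiff_eq_sum (z : Fin s × Fin d → ℝ) (j : Fin s) (g : (Fin s × Fin d → ℝ) → ℝ)
    (y : Fin s × Fin d → ℝ) :
    blockDiff z j g y = ∑ i : Fin d, coordDiff z (j, i) g (replaceInit z j i.1 y) := by
  have h := Finset.sum_range_sub' (fun k => g (replaceInit z j k y)) d
  rw [replaceInit_zero, replaceInit_last, Finset.sum_range] at h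
  rw [blockDiff, ← h]
  refine Finset.sum_congr rfl fun i _ => ?_
  rw [replaceInit_succ, coordDiff]

theorem blockDiffs_coordDiff (z : Fin s × Fin d → ℝ) (L : List (Fin s))
    (l : Fin s × Fin d) (hl : l.1 ∉ L) (g : (Fin s × Fin d → ℝ) → ℝ) :
    blockDiffs z L (coordDiff z l g) = coordDiff z l (blockDiffs z L g) := by
  induction L with
  | nil => rfl
  | cons j L ih =>
    rw [List.mem_cons, not_or] at hl
    ext y
    have e : replaceBlock z j (Function.update y l (z l)) =
        Function.update (replaceBlock z j y) l (z l) := by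
      ext p
      by_cases hp : p = l
      · subst hp; simp [replaceBlock]
      · simp [replaceBlock, hp]
    rw [blockDiffs_cons, ih hl.2, coordDiff, coordDiff, coordDiff, blockDiffs_cons,
      blockDiffs_cons, e]
    ring

theorem mixedDiff_coordDiff {ι : Type*} [Fintype ι] [DecidableEq ι] (z : ι → ℝ) (L : List ι)
    (l : ι) (hl : l ∉ L) (g : (ι → ℝ) → ℝ) :
    mixedDiff z L (coordDiff z l g) = coordDiff z l (mixedDiff z L g) := by
  induction L with
  | nil => rfl
  | cons m L ih =>
    rw [List.mem_cons, not_or] at hl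
    ext y
    rw [mixedDiff_cons, ih hl.2, coordDiff, coordDiff, coordDiff, mixedDiff_cons,
      mixedDiff_cons, Function.update_comm hl.1]
    ring

/-- The choices of one coordinate in each block in the list `L`, normalized to be `i₀` in the
other blocks. -/
def blockChoices (i₀ : Fin d) (L : List (Fin s)) : Finset (Fin s → Fin d) :=
  Fintype.piFinset fun j => if j ∈ L then Finset.univ else {i₀}

theorem mem_blockChoices {i₀ : Fin d} {L : List (Fin s)} {i : Fin s → Fin d} :
    i ∈ blockChoices i₀ L ↔ ∀ j ∉ L, i j = i₀ := by
  rw [blockChoices, Fintype.mem_piFinset]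
  refine forall_congr' fun j => ?_
  by_cases h : j ∈ L <;> simp [h]

theorem sum_blockChoices_cons (i₀ : Fin d) (j : Fin s) (L : List (Fin s)) (hj : j ∉ L)
    (B : (Fin s → Fin d) → ℝ) :
    ∑ i ∈ blockChoices i₀ (j :: L), B i =
      ∑ k : Fin d, ∑ i ∈ blockChoices i₀ L, B (Function.update i j k) := by
  rw [← Finset.sum_product']
  symm
  refine Finset.sum_nbij' (fun p => Function.update p.2 j p.1)
    (fun i => (i j, Function.update i j i₀)) ?_ ?_ ?_ ?_ ?_
  · rintro ⟨k, i⟩ h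
    simp only [Finset.mem_product, Finset.mem_univ, true_and, mem_blockChoices] at h ⊢
    intro m hm
    rw [List.mem_cons, not_or] at hm
    rw [Function.update_of_ne hm.1, h m hm.2]
  · intro i h
    simp only [Finset.mem_product, Finset.mem_univ, true_and, mem_blockChoices] at h ⊢
    intro m hm
    by_cases hmj : m = j
    · subst hmj; simp
    · rw [Function.update_of_ne hmj]
      exact h m (by simp [hmj, hm])
  · rintro ⟨k, i⟩ h
    simp only [Finset.mem_product, Finset.mem_univ, true_and, mem_blockChoices] at h
    simp [← h j hj]
  · intro i _
    simp
  · intro _ _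
    rfl

theorem abs_blockDiffs_le (z : Fin s × Fin d → ℝ) (i₀ : Fin d) (K : Set (Fin s × Fin d → ℝ))
    (hK : ∀ y ∈ K, ∀ l, Function.update y l (z l) ∈ K) (L : List (Fin s)) (hL : L.Nodup)
    (g : (Fin s × Fin d → ℝ) → ℝ) (B : (Fin s → Fin d) → ℝ)
    (hB : ∀ i, ∀ y ∈ K, |mixedDiff z (L.map fun j => (j, i j)) g y| ≤ B i) :
    ∀ y ∈ K, |blockDiffs z L g y| ≤ ∑ i ∈ blockChoices i₀ L, B i := by
  induction L generalizing g B with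
  | nil =>
    intro y hy
    have e : blockChoices i₀ ([] : List (Fin s)) = {fun _ => i₀} := by
      ext i
      simp [mem_blockChoices, funext_iff]
    rw [e, Finset.sum_singleton]
    exact hB _ y hy
  | cons j L ih =>
    intro y hy
    rw [List.nodup_cons] at hL
    have hR : ∀ k ≤ d, replaceInit z j k y ∈ K := by
      intro k
      induction k with
      | zero => intro _; rwa [replaceInit_zero]
      | succ k ihk =>
        intro hk
        have := replaceInit_succ z j ⟨k, hk⟩ y
        simp only at this
        rw [this]
        exact hK _ (ihk (by omega)) _
    have e1 : blockDiffs z (j :: L) g y = blockDiff z j (blockDiffs z L g) y := rfl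
    rw [e1, blockDiff_eq_sum, sum_blockChoices_cons i₀ j L hL.1]
    refine (Finset.abs_sum_le_sum_abs _ _).trans (Finset.sum_le_sum fun k _ => ?_)
    rw [← blockDiffs_coordDiff z L (j, k) hL.1]
    refine ih hL.2 (coordDiff z (j, k) g) (fun i => B (Function.update i j k)) ?_ _
      (hR k.1 k.2.le)
    intro i y' hy'
    have h1 := hB (Function.update i j k) y' hy'
    rw [List.map_cons, Function.update_self] at h1
    rw [mixedDiff_coordDiff]
    · have e2 : (L.map fun j' => (j', Function.update i j k j')) = L.map fun j' => (j', i j') := by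
        refine List.map_congr_left fun m hm => ?_
        rw [Function.update_of_ne]
        rintro rfl
        exact hL.1 hm
      rw [e2] at h1
      exact h1
    · intro h
      obtain ⟨m, hm, he⟩ := List.mem_map.1 h
      exact hL.1 ((Prod.mk.inj he).1 ▸ hm)

/-! ### Sets with one coordinate in each block -/

/-- The set of the chosen coordinates in the blocks in `u`. -/
def choiceSet (u : Finset (Fin s)) (i : Fin s → Fin d) : Finset (Fin s × Fin d) :=
  u.image fun j => (j, i j)

theorem mem_choiceSet {u : Finset (Fin s)} {i : Fin s → Fin d} {p : Fin s × Fin d} :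
    p ∈ choiceSet u i ↔ p.1 ∈ u ∧ p.2 = i p.1 := by
  rw [choiceSet, Finset.mem_image]
  constructor
  · rintro ⟨j, hj, rfl⟩; exact ⟨hj, rfl⟩
  · rintro ⟨h1, h2⟩; exact ⟨p.1, h1, by rw [← h2]⟩

theorem choiceSet_card (u : Finset (Fin s)) (i : Fin s → Fin d) :
    (choiceSet u i).card = u.card :=
  Finset.card_image_of_injective _ fun _ _ h => (Prod.mk.inj h).1

theorem choiceSet_mem_touching (u : Finset (Fin s)) (i : Fin s → Fin d) :
    choiceSet u i ∈ touching d u := by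
  rw [touching, Finset.mem_filter, Finset.mem_powerset]
  refine ⟨fun p hp => ?_, fun j hj => ⟨(j, i j), ?_⟩⟩
  · simpa using (mem_choiceSet.1 hp).1
  · simpa [mem_choiceSet] using hj

theorem list_filter_choiceSet (u : Finset (Fin s)) (i : Fin s → Fin d) :
    (List.finRange s ×ˢ List.finRange d).filter (· ∈ choiceSet u i) =
      ((List.finRange s).filter (· ∈ u)).map fun j => (j, i j) := by
  change List.filter _ (List.product _ _) = _
  rw [List.product]
  generalize List.finRange s = l
  induction l with
  | nil => rfl
  | cons j l ih =>
    rw [List.flatMap_cons, List.filter_append, ih, List.filter_cons, List.filter_map]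
    have e : ((fun x => decide (x ∈ choiceSet u i)) ∘ Prod.mk j) =
        fun k : Fin d => decide (j ∈ u ∧ k = i j) := by
      funext k
      simp [mem_choiceSet]
    rw [e]
    by_cases hj : j ∈ u
    · have e2 : List.filter (fun k => decide (k = i j)) (List.finRange d) = [i j] := by
        rw [List.filter_eq, List.count_eq_one_of_mem (List.nodup_finRange d)
          (List.mem_finRange _)]
        rfl
      simp [hj, e2]
    · simp [hj]

theorem mixedPartial_choiceSet (D : Set (Fin s × Fin d → ℝ)) (e : (Fin s × Fin d → ℝ) → ℝ)
    (u : Finset (Fin s)) (i : Fin s → Fin d) :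
    mixedPartial D e (choiceSet u i) =
      (((List.finRange s).filter (· ∈ u)).map fun j => (j, i j)).foldr
        (fun l h => partialWithin D l h) e := by
  rw [mixedPartial, list_filter_choiceSet]

theorem WeakMixedFamily.ofReal_abs_blockDiffs_le {a b p q : Fin s × Fin d → ℝ}
    {G : Finset (Fin s × Fin d) → (Fin s × Fin d → ℝ) → ℝ} (hG : WeakMixedFamily a b G)
    {e : (Fin s × Fin d → ℝ) → ℝ} (he : EqOn e (G ∅) (Icc a b)) (i₀ : Fin d)
    (hpq : Icc p q ⊆ Icc a b) {z y : Fin s × Fin d → ℝ} (hz : z ∈ Icc p q) (hy : y ∈ Icc p q)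
    (u : Finset (Fin s)) (δ : Fin s → ℝ) (hδ : ∀ j, 0 < δ j)
    (hyz : ∀ l, l.1 ∈ u → |y l - z l| ≤ δ l.1) :
    ENNReal.ofReal |blockDiffs z ((List.finRange s).filter (· ∈ u)) (G ∅) y| ≤
      ENNReal.ofReal (∏ j ∈ u, δ j) * ∑ v ∈ (touching d u).filter (fun v => v.card = u.card),
        ⨆ y ∈ Icc p q, ENNReal.ofReal |mixedPartial (Icc a b) e v y| := by
  set L := (List.finRange s).filter (· ∈ u) with hLdef
  have hLn : L.Nodup := (List.nodup_finRange s).filter _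
  have hLmem : ∀ j, j ∈ L ↔ j ∈ u := fun j => by simp [hLdef]
  set A := fun v => ⨆ y ∈ Icc p q, ENNReal.ofReal |mixedPartial (Icc a b) e v y| with hA
  have hsum : ∑ i ∈ blockChoices i₀ L, A (choiceSet u i) ≤
      ∑ v ∈ (touching d u).filter (fun v => v.card = u.card), A v := by
    rw [← Finset.sum_image (f := A) (g := choiceSet u)]
    · refine Finset.sum_le_sum_of_subset fun v hv => ?_
      obtain ⟨i, _, rfl⟩ := Finset.mem_image.1 hv
      exact Finset.mem_filter.2 ⟨choiceSet_mem_touching u i, choiceSet_card u i⟩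
    · intro i hi i' hi' h
      funext j
      by_cases hj : j ∈ u
      · have : (j, i j) ∈ choiceSet u i' := h ▸ mem_choiceSet.2 ⟨hj, rfl⟩
        exact (mem_choiceSet.1 this).2
      · rw [mem_blockChoices.1 hi j (by rwa [hLmem]), mem_blockChoices.1 hi' j (by rwa [hLmem])]
  refine le_trans ?_ (mul_le_mul_right hsum _)
  have hδ0 : 0 < ∏ j ∈ u, δ j := Finset.prod_pos fun j _ => hδ j
  by_cases htop : ∃ i ∈ blockChoices i₀ L, A (choiceSet u i) = ∞
  · obtain ⟨i, hi, hit⟩ := htop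
    rw [ENNReal.sum_eq_top.2 ⟨i, hi, hit⟩, ENNReal.mul_top]
    · exact le_top
    · simpa using hδ0
  · push Not at htop
    have hch : ∀ i, choiceSet u i = choiceSet u (fun j => if j ∈ u then i j else i₀) := by
      intro i
      ext x
      simp only [mem_choiceSet]
      refine and_congr_right fun hx => ?_
      simp [hx]
    have hfin : ∀ i, A (choiceSet u i) ≠ ∞ := fun i => by
      rw [hch i]
      exact htop _ (mem_blockChoices.2 fun j hj => by
        rw [hLmem] at hj; simp [hj])
    have key := abs_blockDiffs_le z i₀
      {y | y ∈ Icc p q ∧ ∀ l, l.1 ∈ u → |y l - z l| ≤ δ l.1} (by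
        rintro y ⟨hy, hyz⟩ l
        refine ⟨update_mem_Icc hy ⟨hz.1 l, hz.2 l⟩, fun m hm => ?_⟩
        by_cases h : m = l
        · subst h; simpa using (hδ _).le
        · simpa [h] using hyz m hm) L hLn (G ∅)
      (fun i => (A (choiceSet u i)).toReal * ∏ j ∈ u, δ j) (by
        rintro i y ⟨hy, hyz⟩
        have h1 := hG.abs_mixedDiff_le (hpq hz) (L.map fun j => (j, i j))
          (hLn.map fun _ _ h => (Prod.mk.inj h).1) ∅ (by simp) e (hpq hy)
          (fun y' hy' _ => he hy') (A (choiceSet u i)).toReal (by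
            intro y' _ hoff hon
            rw [← mixedPartial_choiceSet]
            have hy'K : y' ∈ Icc p q := by
              refine ⟨fun m => ?_, fun m => ?_⟩
              all_goals
                by_cases hm : m ∈ L.map fun j => (j, i j)
                · have := uIcc_subset_Icc ⟨hz.1 m, hz.2 m⟩ ⟨hy.1 m, hy.2 m⟩ (hon m hm)
                  first | exact this.1 | exact this.2
                · rw [hoff m hm]
                  first | exact hy.1 m | exact hy.2 m
            rw [← ENNReal.ofReal_le_iff_le_toReal (hfin i)]
            exact le_iSup₂ (f := fun y (_ : y ∈ Icc p q) =>
              ENNReal.ofReal |mixedPartial (Icc a b) e (choiceSet u i) y|) y' hy'K)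
        rw [← mixedDiff_congr (hpq hz) _ (hpq hy) (fun y' hy' _ => he hy')]
        refine h1.trans (mul_le_mul_of_nonneg_left ?_ ENNReal.toReal_nonneg)
        rw [List.map_map]
        have e3 : ∏ j ∈ u, δ j = (L.map δ).prod := by
          rw [← List.prod_toFinset δ hLn]
          congr 1
          ext j
          simp [hLmem]
        rw [e3]
        have hmem : ∀ j ∈ L, j ∈ u := fun j hj => (hLmem j).1 hj
        clear_value L
        clear h1 e3 hLmem hLdef hLn hsum htop
        induction L with
        | nil => simp
        | cons j L ih =>
          simp only [List.map_cons, List.prod_cons]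
          refine mul_le_mul (hyz _ (hmem j (by simp))) (ih fun m hm => hmem m (by simp [hm]))
            ?_ (hδ j).le
          refine List.prod_nonneg ?_
          intro r hr
          obtain ⟨m, _, rfl⟩ := List.mem_map.1 hr
          exact abs_nonneg _) y ⟨hy, hyz⟩
    refine (ENNReal.ofReal_le_ofReal key).trans (le_of_eq ?_)
    rw [← Finset.sum_mul, mul_comm, ENNReal.ofReal_mul hδ0.le,
      ENNReal.ofReal_sum_of_nonneg fun _ _ => ENNReal.toReal_nonneg]
    congr 1
    exact Finset.sum_congr rfl fun i _ => ENNReal.ofReal_toReal (hfin i)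

end Block

/-! ### The product measure -/

section ProductMeasure

variable {J : Type*} [Fintype J] {d : ℕ}

/-- The equivalence of `J × Fin d → ℝ` with `J → ℝ^d`. -/
def componentEquiv (J : Type*) (d : ℕ) :
    (J × Fin d → ℝ) ≃ᵐ (J → EuclideanSpace ℝ (Fin d)) where
  toFun := component
  invFun w p := w p.1 p.2
  left_inv _ := rfl
  right_inv _ := rfl
  measurable_toFun := by
    refine measurable_pi_iff.2 fun j => ?_
    exact (PiLp.volume_preserving_toLp (Fin d)).measurable.comp
      (measurable_pi_iff.2 fun i => measurable_pi_apply (j, i))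
  measurable_invFun := by
    refine measurable_pi_iff.2 fun p => ?_
    exact (measurable_pi_apply p.2).comp
      ((PiLp.volume_preserving_ofLp (Fin d)).measurable.comp (measurable_pi_apply p.1))

theorem componentEquiv_apply (x : J × Fin d → ℝ) : componentEquiv J d x = component x := rfl

theorem measurePreserving_uncurry :
    MeasurePreserving (fun (w : J → Fin d → ℝ) (p : J × Fin d) => w p.1 p.2)
      volume volume := by
  have hm : Measurable (fun (w : J → Fin d → ℝ) (p : J × Fin d) => w p.1 p.2) :=
    measurable_pi_iff.2 fun p => (measurable_pi_apply p.2).comp (measurable_pi_apply p.1)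
  refine ⟨hm, ?_⟩
  refine (Measure.pi_eq fun B hB => ?_).symm
  rw [Measure.map_apply hm (MeasurableSet.univ_pi hB)]
  have e : (fun (w : J → Fin d → ℝ) (p : J × Fin d) => w p.1 p.2) ⁻¹' univ.pi B =
      univ.pi fun j => univ.pi fun i => B (j, i) := by
    ext w
    simp [Set.mem_pi]
  rw [e, volume_pi_pi, Fintype.prod_prod_type]
  exact Finset.prod_congr rfl fun j _ => volume_pi_pi _

theorem measurePreserving_componentEquiv :
    MeasurePreserving (componentEquiv J d) volume volume := by
  have h1 : MeasurePreserving (componentEquiv J d).symm volume volume := by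
    have h2 : MeasurePreserving
        (fun (w : J → EuclideanSpace ℝ (Fin d)) (j : J) => WithLp.ofLp (w j)) volume volume :=
      volume_preserving_pi fun _ => PiLp.volume_preserving_ofLp (Fin d)
    exact measurePreserving_uncurry.comp h2
  exact h1.symm _

theorem prodSet_eq_preimage (X : J → Set (EuclideanSpace ℝ (Fin d))) :
    prodSet X = componentEquiv J d ⁻¹' univ.pi X := by
  ext x
  simp [prodSet, componentEquiv_apply]

theorem measurableSet_prodSet {X : J → Set (EuclideanSpace ℝ (Fin d))}
    (hX : ∀ j, MeasurableSet (X j)) : MeasurableSet (prodSet X) := by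
  rw [prodSet_eq_preimage]
  exact (componentEquiv J d).measurable (MeasurableSet.univ_pi hX)

theorem measurePreserving_component {X : J → Set (EuclideanSpace ℝ (Fin d))}
    (hX : ∀ j, MeasurableSet (X j)) :
    MeasurePreserving (componentEquiv J d) (volume.restrict (prodSet X))
      (Measure.pi fun j => volume.restrict (X j)) := by
  rw [← Measure.restrict_pi_pi, prodSet_eq_preimage]
  exact measurePreserving_componentEquiv.restrict_preimage (MeasurableSet.univ_pi hX)

theorem isProbabilityMeasure_restrict {E : Type*} [MeasureSpace E] {A : Set E}
    (h : volume A = 1) : IsProbabilityMeasure (volume.restrict A) :=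
  ⟨by rw [Measure.restrict_apply_univ, h]⟩

theorem isProbabilityMeasure_prodSet {X : J → Set (EuclideanSpace ℝ (Fin d))}
    (hX : ∀ j, MeasurableSet (X j)) (hv : ∀ j, volume (X j) = 1) :
    IsProbabilityMeasure (volume.restrict (prodSet X)) := by
  have := fun j => isProbabilityMeasure_restrict (hv j)
  exact ⟨by
    rw [← preimage_univ (f := componentEquiv J d), (measurePreserving_component hX).measure_preimage
      nullMeasurableSet_univ, measure_univ]⟩

end ProductMeasure

section Glue

variable {I : Type*} [Fintype I] [DecidableEq I] {E : I → Type*} [∀ i, MeasurableSpace (E i)]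
  (μ : ∀ i, Measure (E i)) [∀ i, IsProbabilityMeasure (μ i)]

theorem measurePreserving_pi_glue (u : Finset I) :
    MeasurePreserving (fun (q : (∀ i, E i) × (∀ i : {i // i ∉ u}, E i)) (i : I) =>
        if h : i ∈ u then q.1 i else q.2 ⟨i, h⟩)
      ((Measure.pi μ).prod (Measure.pi fun i : {i // i ∉ u} => μ i)) (Measure.pi μ) := by
  have hm : Measurable (fun (q : (∀ i, E i) × (∀ i : {i // i ∉ u}, E i)) (i : I) =>
      if h : i ∈ u then q.1 i else q.2 ⟨i, h⟩) := by
    refine measurable_pi_iff.2 fun i => ?_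
    by_cases h : i ∈ u
    · simp only [h, dif_pos]; exact (measurable_pi_apply i).comp measurable_fst
    · simp only [h, dif_neg, not_false_eq_true]
      exact (measurable_pi_apply (⟨i, h⟩ : {i // i ∉ u})).comp measurable_snd
  refine ⟨hm, (Measure.pi_eq fun B hB => ?_).symm⟩
  rw [Measure.map_apply hm (MeasurableSet.univ_pi hB)]
  have e : (fun (q : (∀ i, E i) × (∀ i : {i // i ∉ u}, E i)) (i : I) =>
      if h : i ∈ u then q.1 i else q.2 ⟨i, h⟩) ⁻¹' univ.pi B =
      (univ.pi fun i => if i ∈ u then B i else univ) ×ˢ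
        (univ.pi fun i : {i // i ∉ u} => B i) := by
    ext q
    simp only [mem_preimage, mem_univ_pi, mem_prod, Subtype.forall]
    rw [← forall_and]
    refine forall_congr' fun i => ?_
    by_cases h : i ∈ u <;> simp [h]
  rw [e, Measure.prod_prod, Measure.pi_pi, Measure.pi_pi,
    ← Fintype.prod_subtype_mul_prod_subtype (fun i => i ∈ u) (fun i => μ i (B i))]
  congr 1
  rw [← Fintype.prod_subtype_mul_prod_subtype (fun i => i ∈ u)]
  refine (congrArg₂ (· * ·) (Finset.prod_congr rfl fun i _ => ?_)
    (Finset.prod_eq_one fun i _ => ?_)).trans (mul_one _)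
  · simp [i.2]
  · simp [i.2]

theorem measurePreserving_pi_update (j : I) :
    MeasurePreserving (fun (q : (∀ i, E i) × (∀ i, E i)) (i : I) =>
        if i = j then q.2 i else q.1 i)
      ((Measure.pi μ).prod (Measure.pi μ)) (Measure.pi μ) := by
  have hm : Measurable (fun (q : (∀ i, E i) × (∀ i, E i)) (i : I) =>
      if i = j then q.2 i else q.1 i) := by
    refine measurable_pi_iff.2 fun i => ?_
    by_cases h : i = j
    · subst h; simp only [if_true]; exact (measurable_pi_apply i).comp measurable_snd
    · simp only [h, if_false]; exact (measurable_pi_apply i).comp measurable_fst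
  refine ⟨hm, (Measure.pi_eq fun B hB => ?_).symm⟩
  rw [Measure.map_apply hm (MeasurableSet.univ_pi hB)]
  have e : (fun (q : (∀ i, E i) × (∀ i, E i)) (i : I) => if i = j then q.2 i else q.1 i) ⁻¹'
      univ.pi B = (univ.pi fun i => if i = j then univ else B i) ×ˢ
        (univ.pi fun i => if i = j then B i else univ) := by
    ext q
    simp only [mem_preimage, mem_univ_pi, mem_prod]
    rw [← forall_and]
    refine forall_congr' fun i => ?_
    by_cases h : i = j <;> simp [h]
  rw [e, Measure.prod_prod, Measure.pi_pi, Measure.pi_pi, ← Finset.prod_mul_distrib]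
  refine Finset.prod_congr rfl fun i _ => ?_
  by_cases h : i = j <;> simp [h]

end Glue

section Region

variable {s d : ℕ} {X : Fin s → Set (EuclideanSpace ℝ (Fin d))}

theorem measurePreserving_glue (hX : ∀ j, MeasurableSet (X j)) (hv : ∀ j, volume (X j) = 1)
    (u : Finset (Fin s)) :
    MeasurePreserving (fun q : (Fin s × Fin d → ℝ) × ({j : Fin s // j ∉ u} × Fin d → ℝ) =>
        glue u q.1 q.2)
      ((volume.restrict (prodSet X)).prod
        (volume.restrict (prodSet fun j : {j : Fin s // j ∉ u} => X j.1)))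
      (volume.restrict (prodSet X)) := by
  have := fun j => isProbabilityMeasure_restrict (hv j)
  have h1 := (measurePreserving_component hX).prod
    (measurePreserving_component (X := fun j : {j : Fin s // j ∉ u} => X j.1) fun j => hX j)
  have h2 := (measurePreserving_component hX).symm
  have h3 := h2.comp ((measurePreserving_pi_glue (fun j => volume.restrict (X j)) u).comp h1)
  convert h3 using 1
  funext q p
  change glue u q.1 q.2 p = (if h : p.1 ∈ u then component q.1 p.1 else
    component q.2 ⟨p.1, h⟩) p.2
  by_cases h : p.1 ∈ u <;> simp [glue, h, component]

theorem measurePreserving_replaceBlock (hX : ∀ j, MeasurableSet (X j))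
    (hv : ∀ j, volume (X j) = 1) (j : Fin s) :
    MeasurePreserving (fun q : (Fin s × Fin d → ℝ) × (Fin s × Fin d → ℝ) =>
        replaceBlock q.2 j q.1)
      ((volume.restrict (prodSet X)).prod (volume.restrict (prodSet X)))
      (volume.restrict (prodSet X)) := by
  have := fun j => isProbabilityMeasure_restrict (hv j)
  have h1 := (measurePreserving_component hX).prod (measurePreserving_component hX)
  have h2 := (measurePreserving_component hX).symm
  have h3 := h2.comp ((measurePreserving_pi_update (fun j => volume.restrict (X j)) j).comp h1)
  convert h3 using 1
  funext q p
  change replaceBlock q.2 j q.1 p = (if p.1 = j then component q.2 p.1 else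
    component q.1 p.1) p.2
  by_cases h : p.1 = j
  · simp only [replaceBlock, h, if_true]; rw [← h]; rfl
  · simp only [replaceBlock, h, if_false]; rfl

/-- If `h` does not depend on the `j`-th component and `Ψ j` has integral zero over `X j`, then
the integral of `h(x) ∏ Ψ_i(x_i)` is zero. -/
theorem integral_mul_prod_eq_zero (hX : ∀ j, MeasurableSet (X j))
    (hv : ∀ j, volume (X j) = 1) (Ψ : Fin s → EuclideanSpace ℝ (Fin d) → ℝ) (j : Fin s)
    (hΨm : Measurable (Ψ j)) (hΨ : ∫ x in X j, Ψ j x = 0) (h : (Fin s × Fin d → ℝ) → ℝ)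
    (hh : ∀ x y, h (replaceBlock y j x) = h x) :
    ∫ x in prodSet X, h x * ∏ i, Ψ i (component x i) = 0 := by
  have := isProbabilityMeasure_prodSet hX hv
  have := fun j => isProbabilityMeasure_restrict (hv j)
  by_cases hi : Integrable (fun x => h x * ∏ i, Ψ i (component x i))
    (volume.restrict (prodSet X))
  swap
  · exact integral_undef hi
  have hmp := measurePreserving_replaceBlock hX hv j
  have h0 := hi.aestronglyMeasurable
  rw [← hmp.map_eq] at h0 ⊢
  rw [integral_map hmp.measurable.aemeasurable h0]
  have e : ∀ q : (Fin s × Fin d → ℝ) × (Fin s × Fin d → ℝ),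
      h (replaceBlock q.2 j q.1) * ∏ i, Ψ i (component (replaceBlock q.2 j q.1) i) =
      (h q.1 * ∏ i ∈ Finset.univ.erase j, Ψ i (component q.1 i)) * Ψ j (component q.2 j) := by
    intro q
    rw [hh, ← Finset.mul_prod_erase _ _ (Finset.mem_univ j)]
    have e1 : component (replaceBlock q.2 j q.1) j = component q.2 j := by
      ext i; simp [component, replaceBlock]
    have e2 : ∀ i ∈ Finset.univ.erase j,
        Ψ i (component (replaceBlock q.2 j q.1) i) = Ψ i (component q.1 i) := by
      intro i hi
      congr 1
      ext k
      simp [component, replaceBlock, Finset.ne_of_mem_erase hi]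
    rw [e1, Finset.prod_congr rfl e2]
    ring
  simp_rw [e]
  rw [integral_prod_mul (fun x => h x * ∏ i ∈ Finset.univ.erase j, Ψ i (component x i))
    (fun y => Ψ j (component y j))]
  have e3 : ∫ y in prodSet X, Ψ j (component y j) = ∫ x in X j, Ψ j x := by
    have hmp2 := (measurePreserving_eval (fun j => volume.restrict (X j)) j).comp
      (measurePreserving_component hX)
    rw [← hmp2.map_eq, integral_map hmp2.measurable.aemeasurable
      hΨm.aestronglyMeasurable]
    rfl
  rw [e3, hΨ, mul_zero]

theorem integral_prod_component (hX : ∀ j, MeasurableSet (X j))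
    (Ψ : Fin s → EuclideanSpace ℝ (Fin d) → ℝ) :
    ∫ x in prodSet X, ∏ i, Ψ i (component x i) = ∏ i, ∫ x in X i, Ψ i x := by
  rw [← integral_fintype_prod_eq_prod (𝕜 := ℝ) Ψ (μ := fun j => volume.restrict (X j)),
    ← (measurePreserving_component hX).integral_comp
      (componentEquiv (Fin s) d).measurableEmbedding]
  rfl

/-- Mixed differences along blocks do not change the integral against a product of functions
with integral zero. -/
theorem integral_blockDiffs_mul (hX : ∀ j, MeasurableSet (X j)) (hv : ∀ j, volume (X j) = 1)
    (Ψ : Fin s → EuclideanSpace ℝ (Fin d) → ℝ) (hΨm : ∀ j, Measurable (Ψ j))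
    (hΨb : ∀ j, ∃ M, ∀ x, |Ψ j x| ≤ M) (z : Fin s × Fin d → ℝ) (L : List (Fin s))
    (hΨ : ∀ j ∈ L, ∫ x in X j, Ψ j x = 0) (g : (Fin s × Fin d → ℝ) → ℝ) (hg : Measurable g)
    (hgb : ∃ M, ∀ x, |g x| ≤ M) :
    (Measurable (blockDiffs z L g) ∧ ∃ M, ∀ x, |blockDiffs z L g x| ≤ M) ∧
    ∫ x in prodSet X, blockDiffs z L g x * ∏ i, Ψ i (component x i) =
      ∫ x in prodSet X, g x * ∏ i, Ψ i (component x i) := by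
  have := isProbabilityMeasure_prodSet hX hv
  have hint : ∀ h : (Fin s × Fin d → ℝ) → ℝ, Measurable h → (∃ M, ∀ x, |h x| ≤ M) →
      Integrable (fun x => h x * ∏ i, Ψ i (component x i)) (volume.restrict (prodSet X)) := by
    rintro h hm ⟨M, hM⟩
    choose N hN using hΨb
    refine Integrable.of_bound (C := M * ∏ i, N i) ?_ (Filter.Eventually.of_forall fun x => ?_)
    · refine (hm.mul (Finset.measurable_prod _ fun i _ => ?_)).aestronglyMeasurable
      exact (hΨm i).comp ((measurable_pi_apply i).comp (componentEquiv (Fin s) d).measurable)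
    · rw [norm_mul, Real.norm_eq_abs, norm_prod]
      refine mul_le_mul (hM x) (Finset.prod_le_prod (fun _ _ => norm_nonneg _)
        fun i _ => hN i _) (Finset.prod_nonneg fun _ _ => norm_nonneg _)
        ((abs_nonneg _).trans (hM x))
  induction L with
  | nil => exact ⟨⟨hg, hgb⟩, rfl⟩
  | cons j L ih =>
    obtain ⟨⟨hm, M, hM⟩, hI⟩ := ih fun m hm => hΨ m (List.mem_cons_of_mem _ hm)
    have hrm : Measurable (replaceBlock z j) := by
      refine measurable_pi_iff.2 fun p => ?_
      by_cases h : p.1 = j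
      · simp only [replaceBlock, h, if_true]; exact measurable_const
      · simp only [replaceBlock, h, if_false]; exact measurable_pi_apply p
    have hM2 : ∀ x, |blockDiffs z (j :: L) g x| ≤ M + M := fun x =>
      (abs_sub _ _).trans (add_le_add (hM _) (hM _))
    refine ⟨⟨hm.sub (hm.comp hrm), M + M, hM2⟩, ?_⟩
    have h0 := integral_mul_prod_eq_zero hX hv Ψ j (hΨm j) (hΨ j (by simp))
      (fun x => blockDiffs z L g (replaceBlock z j x)) (by
        intro x y
        congr 1
        ext p
        by_cases h : p.1 = j <;> simp [replaceBlock, h])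
    rw [← hI, ← sub_zero (∫ x in prodSet X, blockDiffs z L g x * ∏ i, Ψ i (component x i)),
      ← h0, ← integral_sub (hint _ hm ⟨M, hM⟩) 
        (hint (fun x => blockDiffs z L g (replaceBlock z j x)) (hm.comp hrm) ⟨M, fun x => hM _⟩)]
    refine integral_congr_ae (Filter.Eventually.of_forall fun x => ?_)
    simp only [blockDiffs_cons, sub_mul]

end Region

/-! ### Cells and the univariate basis functions -/

section Cells

variable {d b : ℕ} {A : Set (EuclideanSpace ℝ (Fin d))} (S : RecursiveSplit b A)

namespace RecursiveSplit

theorem measurableSet_cell (k t : ℕ) (ht : t < b ^ k) : MeasurableSet (S.cell k t) := by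
  rw [(S.isSplit k t ht).union]
  exact MeasurableSet.iUnion (S.isSplit k t ht).borel

theorem child_subset (k t : ℕ) (ht : t < b ^ k) (c : Fin b) :
    S.cell (k + 1) (b * t + c) ⊆ S.cell k t := by
  rw [(S.isSplit k t ht).union]
  exact subset_iUnion (fun c : Fin b => S.cell (k + 1) (b * t + c)) c

theorem index_div_lt {k t : ℕ} (ht : t < b ^ (k + 1)) : t / b < b ^ k :=
  Nat.div_lt_of_lt_mul (by rwa [← pow_succ'])

theorem cell_subset (hb : 2 ≤ b) (k t : ℕ) (ht : t < b ^ k) : S.cell k t ⊆ A := by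
  induction k generalizing t with
  | zero =>
    obtain rfl : t = 0 := by simpa using ht
    rw [S.cell_zero]
  | succ k ih =>
    have h := S.child_subset k (t / b) (index_div_lt ht) ⟨t % b, Nat.mod_lt _ (by omega)⟩
    rw [Nat.div_add_mod] at h
    exact h.trans (ih _ (index_div_lt ht))

theorem volume_cell (hb : 2 ≤ b) (hA : volume A = 1) (k t : ℕ) (ht : t < b ^ k) :
    volume (S.cell k t) = ((b : ℝ≥0∞) ^ k)⁻¹ := by
  induction k generalizing t with
  | zero =>
    obtain rfl : t = 0 := by simpa using ht
    rw [S.cell_zero, hA]; simp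
  | succ k ih =>
    have h := (S.isSplit k (t / b) (index_div_lt ht)).volume_eq ⟨t % b, Nat.mod_lt _ (by omega)⟩
    simp only [Nat.div_add_mod] at h
    rw [h, ih _ (index_div_lt ht), div_eq_mul_inv, pow_succ, ENNReal.mul_inv]
    · right; exact ENNReal.natCast_ne_top b
    · left; exact ENNReal.pow_ne_top (ENNReal.natCast_ne_top b)

theorem setIntegral_indicator_cell (hb : 2 ≤ b) (hA : volume A = 1) (k t : ℕ) (ht : t < b ^ k) :
    ∫ x in A, (S.cell k t).indicator (1 : EuclideanSpace ℝ (Fin d) → ℝ) x = ((b : ℝ) ^ k)⁻¹ := by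
  rw [integral_indicator_one (S.measurableSet_cell k t ht), measureReal_restrict_apply
    (S.measurableSet_cell k t ht), inter_eq_left.2 (S.cell_subset hb k t ht), measureReal_def,
    S.volume_cell hb hA k t ht]
  simp

end RecursiveSplit

theorem child_index_lt {k t : ℕ} (ht : t < b ^ k) (c : Fin b) : b * t + c < b ^ (k + 1) := by
  rw [pow_succ']
  calc b * t + c < b * t + b := by omega
    _ = b * (t + 1) := by ring
    _ ≤ b * b ^ k := Nat.mul_le_mul_left _ ht

theorem measurable_haar (k t : ℕ) (ht : t < b ^ k) (c : Fin b) :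
    Measurable (haar S k t c) := by
  have h1 := S.measurableSet_cell k t ht
  have h2 := S.measurableSet_cell (k + 1) (b * t + c) (child_index_lt ht c)
  exact ((measurable_one.indicator h2).const_mul _).sub ((measurable_one.indicator h1).const_mul _)

theorem haar_eq_zero {k t : ℕ} (ht : t < b ^ k) (c : Fin b) {x : EuclideanSpace ℝ (Fin d)}
    (hx : x ∉ S.cell k t) : haar S k t c x = 0 := by
  have : x ∉ S.cell (k + 1) (b * t + c) := fun h => hx (S.child_subset k t ht c h)
  simp [haar, hx, this]

theorem haar_coeff (hb : 2 ≤ b) (k : ℕ) :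
    (b : ℝ) ^ (((k : ℝ) + 1) / 2) = b * (b : ℝ) ^ (((k : ℝ) - 1) / 2) := by
  have hb0 : (0 : ℝ) < b := by exact_mod_cast (by omega : 0 < b)
  nth_rewrite 2 [← Real.rpow_one (b : ℝ)]
  rw [← Real.rpow_add hb0]
  ring_nf

theorem abs_haar_eq (hb : 2 ≤ b) {k t : ℕ} (ht : t < b ^ k) (c : Fin b)
    (x : EuclideanSpace ℝ (Fin d)) :
    |haar S k t c x| = (b : ℝ) ^ (((k : ℝ) - 1) / 2) *
      ((b - 2) * (S.cell (k + 1) (b * t + c)).indicator 1 x + (S.cell k t).indicator 1 x) := by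
  have hb2 : (2 : ℝ) ≤ b := by exact_mod_cast hb
  have hβ : 0 < (b : ℝ) ^ (((k : ℝ) - 1) / 2) := Real.rpow_pos_of_pos (by linarith) _
  rw [haar, haar_coeff hb]
  set β := (b : ℝ) ^ (((k : ℝ) - 1) / 2)
  by_cases h1 : x ∈ S.cell (k + 1) (b * t + c)
  · have h2 := S.child_subset k t ht c h1
    simp only [h1, h2, indicator_of_mem, Pi.one_apply]
    rw [abs_of_nonneg (by nlinarith)]
    ring
  · by_cases h2 : x ∈ S.cell k t
    · simp [h1, h2, abs_of_pos hβ]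
    · simp [h1, h2]

theorem integrable_indicator_cell (hA : volume A = 1) (k t : ℕ) (ht : t < b ^ k) :
    Integrable (fun x => (S.cell k t).indicator (1 : EuclideanSpace ℝ (Fin d) → ℝ) x)
      (volume.restrict A) := by
  have := isProbabilityMeasure_restrict hA
  exact (integrable_const (1 : ℝ)).indicator (S.measurableSet_cell k t ht)

theorem setIntegral_haar (hb : 2 ≤ b) (hA : volume A = 1) {k t : ℕ} (ht : t < b ^ k)
    (c : Fin b) : ∫ x in A, haar S k t c x = 0 := by
  have hb0 : (b : ℝ) ≠ 0 := by exact_mod_cast (by omega : b ≠ 0)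
  have h1 := integrable_indicator_cell S hA k t ht
  have h2 := integrable_indicator_cell S hA (k + 1) (b * t + c) (child_index_lt ht c)
  simp only [haar]
  rw [integral_sub (h2.const_mul _) (h1.const_mul _), integral_const_mul, integral_const_mul,
    S.setIntegral_indicator_cell hb hA _ _ ht,
    S.setIntegral_indicator_cell hb hA _ _ (child_index_lt ht c), haar_coeff hb, pow_succ]
  field_simp
  ring

theorem setIntegral_abs_haar (hb : 2 ≤ b) (hA : volume A = 1) {k t : ℕ} (ht : t < b ^ k)
    (c : Fin b) : ∫ x in A, |haar S k t c x| =
      (2 - 2 / (b : ℝ)) * (b : ℝ) ^ (-((k : ℝ) / 2) - 1 / 2) := by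
  have hb0 : (0 : ℝ) < b := by exact_mod_cast (by omega : 0 < b)
  have h1 := integrable_indicator_cell S hA k t ht
  have h2 := integrable_indicator_cell S hA (k + 1) (b * t + c) (child_index_lt ht c)
  simp only [abs_haar_eq S hb ht c]
  rw [integral_const_mul, integral_add (h2.const_mul _) h1, integral_const_mul,
    S.setIntegral_indicator_cell hb hA _ _ ht,
    S.setIntegral_indicator_cell hb hA _ _ (child_index_lt ht c)]
  have e : (b : ℝ) ^ (((k : ℝ) - 1) / 2) = (b : ℝ) ^ (-((k : ℝ) / 2) - 1 / 2) * (b : ℝ) ^ k := by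
    rw [← Real.rpow_natCast, ← Real.rpow_add hb0]
    ring_nf
  rw [e, pow_succ]
  field_simp
  ring

end Cells

/-! ### Rectangular hulls -/

section Hull

variable {ι : Type*} [Fintype ι]

theorem rectHull_eq_Icc (A : Set (ι → ℝ)) :
    rectHull A = Icc (fun l => sInf ((fun x : ι → ℝ => x l) '' A))
      (fun l => sSup ((fun x : ι → ℝ => x l) '' A)) := by
  ext y
  simp only [rectHull, mem_ofPred_eq, mem_Icc, Pi.le_def, forall_and]

theorem subset_rectHull {A : Set (ι → ℝ)} (hA : Bornology.IsBounded A) : A ⊆ rectHull A := by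
  intro x hx l
  have hb : Bornology.IsBounded ((fun x : ι → ℝ => x l) '' A) := (hA.image_eval l)
  exact ⟨csInf_le hb.bddBelow ⟨x, hx, rfl⟩, le_csSup hb.bddAbove ⟨x, hx, rfl⟩⟩

theorem rectHull_mono {A B : Set (ι → ℝ)} (h : A ⊆ B) (hA : A.Nonempty)
    (hB : Bornology.IsBounded B) : rectHull A ⊆ rectHull B := by
  intro x hx l
  have hb : Bornology.IsBounded ((fun x : ι → ℝ => x l) '' B) := (hB.image_eval l)
  exact ⟨(csInf_le_csInf hb.bddBelow (hA.image _) (image_mono h)).trans (hx l).1,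
    (hx l).2.trans (csSup_le_csSup hb.bddAbove (hA.image _) (image_mono h))⟩

end Hull

section Bound

variable {s d b : ℕ} {X : Fin s → Set (EuclideanSpace ℝ (Fin d))}

theorem isBounded_prodSet (hX : ∀ j, Bornology.IsBounded (X j)) :
    Bornology.IsBounded (prodSet X) := by
  rw [← Bornology.forall_isBounded_image_eval_iff]
  rintro ⟨j, i⟩
  obtain ⟨M, hM⟩ := (hX j).exists_norm_le
  refine (Metric.isBounded_closedBall (x := (0 : ℝ)) (r := M)).subset ?_
  rintro _ ⟨x, hx, rfl⟩
  rw [mem_closedBall_zero_iff]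
  exact (PiLp.norm_apply_le (component x j) i).trans (hM _ (hx j))

theorem abs_coord_sub_le_diam {A : Set (EuclideanSpace ℝ (Fin d))}
    (hA : Bornology.IsBounded A) {x y : EuclideanSpace ℝ (Fin d)} (hx : x ∈ A) (hy : y ∈ A)
    (i : Fin d) : |x i - y i| ≤ Metric.diam A := by
  refine le_trans ?_ (Metric.dist_le_diam_of_mem hA hx hy)
  rw [dist_eq_norm]
  exact PiLp.norm_apply_le (x - y) i

variable (S : ∀ j, RecursiveSplit b (X j)) (u : Finset (Fin s)) (κ : u → ℕ)
  (τ : ∀ j : u, Fin (b ^ κ j)) (γ : u → Fin b)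

/-- The factor of `multiHaar` that depends on the `j`-th component. -/
def blockHaar (j : Fin s) (x : EuclideanSpace ℝ (Fin d)) : ℝ :=
  if h : j ∈ u then haar (S j) (κ ⟨j, h⟩) (τ ⟨j, h⟩) (γ ⟨j, h⟩) x else (X j).indicator 1 x

theorem multiHaar_eq_prod (x : Fin s × Fin d → ℝ) :
    multiHaar S u κ τ γ x = ∏ j, blockHaar S u κ τ γ j (component x j) := by
  rw [multiHaar, ← Finset.prod_mul_prod_compl u, ← Finset.prod_coe_sort u]
  congr 1
  · exact Finset.prod_congr rfl fun j _ => by simp [blockHaar]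
  · exact Finset.prod_congr rfl fun j hj => by
      simp [blockHaar, Finset.mem_compl.1 hj]

theorem measurable_blockHaar (hX : ∀ j, MeasurableSet (X j)) (j : Fin s) :
    Measurable (blockHaar S u κ τ γ j) := by
  by_cases h : j ∈ u
  · have : blockHaar S u κ τ γ j = haar (S j) (κ ⟨j, h⟩) (τ ⟨j, h⟩) (γ ⟨j, h⟩) := by
      funext x; simp [blockHaar, h]
    rw [this]
    exact measurable_haar _ _ _ (τ ⟨j, h⟩).2 _
  · have : blockHaar S u κ τ γ j = (X j).indicator 1 := by
      funext x; simp [blockHaar, h]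
    rw [this]
    exact measurable_one.indicator (hX j)

theorem bounded_blockHaar (j : Fin s) : ∃ M, ∀ x, |blockHaar S u κ τ γ j x| ≤ M := by
  have hi : ∀ (A : Set (EuclideanSpace ℝ (Fin d))) x,
      |A.indicator (1 : EuclideanSpace ℝ (Fin d) → ℝ) x| ≤ 1 := by
    intro A x
    by_cases h : x ∈ A <;> simp [h]
  by_cases h : j ∈ u
  · simp only [blockHaar, h, dif_pos, haar]
    exact ⟨_, fun x => (abs_sub _ _).trans (add_le_add
      ((abs_mul _ _).trans_le (mul_le_mul_of_nonneg_left (hi _ x) (abs_nonneg _)))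
      ((abs_mul _ _).trans_le (mul_le_mul_of_nonneg_left (hi _ x) (abs_nonneg _))))⟩
  · exact ⟨1, fun x => by simpa only [blockHaar, h, dif_neg, not_false_eq_true] using hi _ x⟩

/-- The tuple `κ`, extended by `0`. -/
def extendZero (j : Fin s) : ℕ := if h : j ∈ u then κ ⟨j, h⟩ else 0

theorem setIntegral_blockHaar (hb : 2 ≤ b) (hv : ∀ j, volume (X j) = 1) {j : Fin s}
    (hj : j ∈ u) : ∫ x in X j, blockHaar S u κ τ γ j x = 0 := by
  simp only [blockHaar, hj, dif_pos]
  exact setIntegral_haar (S j) hb (hv j) (τ ⟨j, hj⟩).2 _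

theorem setIntegral_abs_multiHaar (hb : 2 ≤ b) (hX : ∀ j, MeasurableSet (X j))
    (hv : ∀ j, volume (X j) = 1) :
    ∫ x in prodSet X, |multiHaar S u κ τ γ x| =
      ∏ j ∈ u, (2 - 2 / (b : ℝ)) * (b : ℝ) ^ (-((extendZero u κ j : ℝ) / 2) - 1 / 2) := by
  simp_rw [multiHaar_eq_prod, Finset.abs_prod]
  rw [integral_prod_component hX fun j x => |blockHaar S u κ τ γ j x|,
    ← Finset.prod_mul_prod_compl u, Finset.prod_eq_one (s := uᶜ), mul_one]
  · refine Finset.prod_congr rfl fun j hj => ?_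
    simp only [blockHaar, extendZero, hj, dif_pos]
    exact setIntegral_abs_haar (S j) hb (hv j) (τ ⟨j, hj⟩).2 _
  · intro j hj
    have := isProbabilityMeasure_restrict (hv j)
    simp only [blockHaar, Finset.mem_compl.1 hj, dif_neg, not_false_eq_true]
    rw [setIntegral_congr_fun (g := fun _ => (1 : ℝ)) (hX j) fun x hx => by simp [hx]]
    simp

theorem multiHaar_eq_zero {x : Fin s × Fin d → ℝ} (hx : x ∉ cellProd S u κ τ) :
    multiHaar S u κ τ γ x = 0 := by
  rw [multiHaar_eq_prod]
  simp only [cellProd, prodSet, mem_ofPred_eq, not_forall] at hx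
  obtain ⟨j, hj⟩ := hx
  refine Finset.prod_eq_zero (Finset.mem_univ j) ?_
  by_cases h : j ∈ u
  · simp only [h, dif_pos] at hj
    simp only [blockHaar, h, dif_pos]
    exact haar_eq_zero (S j) (τ ⟨j, h⟩).2 _ hj
  · simp only [h, dif_neg, not_false_eq_true] at hj
    simp [blockHaar, h, hj]

theorem cellProd_subset (hb : 2 ≤ b) : cellProd S u κ τ ⊆ prodSet X := by
  intro x hx j
  have := hx j
  by_cases h : j ∈ u
  · simp only [h, dif_pos] at this
    exact (S j).cell_subset hb _ _ (τ ⟨j, h⟩).2 this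
  · simpa only [h, dif_neg, not_false_eq_true] using this

theorem cellProd_nonempty (hb : 2 ≤ b) (hv : ∀ j, volume (X j) = 1) :
    (cellProd S u κ τ).Nonempty := by
  have h : ∀ j, (if h : j ∈ u then (S j).cell (κ ⟨j, h⟩) (τ ⟨j, h⟩) else X j).Nonempty := by
    intro j
    refine nonempty_of_measure_ne_zero (μ := volume) ?_
    by_cases h : j ∈ u
    · simp only [h, dif_pos]
      rw [(S j).volume_cell hb (hv j) _ _ (τ ⟨j, h⟩).2]
      simp
    · simp [h, hv j]
  choose w hw using h
  exact ⟨fun p => w p.1 p.2, hw⟩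

theorem coefficient_eq (hb : 2 ≤ b) (C : ℝ) :
    (∏ j ∈ u, C * (b : ℝ) ^ (-((extendZero u κ j : ℝ) / (d : ℝ)))) *
      ∏ j ∈ u, (2 - 2 / (b : ℝ)) * (b : ℝ) ^ (-((extendZero u κ j : ℝ) / 2) - 1 / 2) =
    ((2 - 2 / (b : ℝ)) ^ u.card *
      (b : ℝ) ^ (-(((∑ j, κ j : ℕ) : ℝ) / 2 * (1 + 2 / (d : ℝ))) - (u.card : ℝ) / 2)) *
      C ^ u.card := by
  have hb0 : (0 : ℝ) < b := by exact_mod_cast (by omega : 0 < b)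
  have e : (∑ j, κ j) = ∑ j ∈ u, extendZero u κ j := by
    rw [← Finset.sum_coe_sort u]
    exact Finset.sum_congr rfl fun j _ => by simp [extendZero]
  have e2 : (b : ℝ) ^ (-(((∑ j, κ j : ℕ) : ℝ) / 2 * (1 + 2 / (d : ℝ))) - (u.card : ℝ) / 2) =
      ∏ j ∈ u, (b : ℝ) ^ (-((extendZero u κ j : ℝ) / (d : ℝ)) +
        (-((extendZero u κ j : ℝ) / 2) - 1 / 2)) := by
    rw [← Real.rpow_sum_of_pos hb0, e]
    congr 1
    push_cast
    rw [Finset.sum_add_distrib, Finset.sum_sub_distrib, Finset.sum_neg_distrib,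
      Finset.sum_neg_distrib, ← Finset.sum_div, ← Finset.sum_div, Finset.sum_const, nsmul_eq_mul]
    ring
  rw [e2, ← Finset.prod_const, ← Finset.prod_const, ← Finset.prod_mul_distrib,
    ← Finset.prod_mul_distrib, ← Finset.prod_mul_distrib]
  refine Finset.prod_congr rfl fun j _ => ?_
  rw [Real.rpow_add hb0]
  ring

/-- The coefficient bound for a function with weak mixed derivatives on the rectangular hull. -/
theorem WeakMixedFamily.coefficient_le (hd : 0 < d) (hb : 2 ≤ b)
    (hXm : ∀ j, MeasurableSet (X j)) (hXb : ∀ j, Bornology.IsBounded (X j))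
    (hXv : ∀ j, volume (X j) = 1) {C : ℝ} (hC : 1 ≤ C)
    (hdiam : ∀ j k t, t < b ^ k →
      Metric.diam ((S j).cell k t) ≤ C * (b : ℝ) ^ (-((k : ℝ) / (d : ℝ))))
    {p q : Fin s × Fin d → ℝ} (hpq : rectHull (prodSet X) = Icc p q)
    {G : Finset (Fin s × Fin d) → (Fin s × Fin d → ℝ) → ℝ} (hG : WeakMixedFamily p q G)
    {e : (Fin s × Fin d → ℝ) → ℝ} (he : EqOn e (G ∅) (rectHull (prodSet X))) :
    ENNReal.ofReal |∫ x in prodSet X, G ∅ x * multiHaar S u κ τ γ x| ≤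
      coefficientBound S C u κ τ e := by
  have hb0 : (0 : ℝ) < b := by exact_mod_cast (by omega : 0 < b)
  have hsub := cellProd_subset S u κ τ hb
  have hPb := isBounded_prodSet hXb
  obtain ⟨z, hz⟩ := cellProd_nonempty S u κ τ hb hXv
  have hhull : cellProd S u κ τ ⊆ rectHull (cellProd S u κ τ) :=
    subset_rectHull (hPb.subset hsub)
  have hmono : rectHull (cellProd S u κ τ) ⊆ rectHull (prodSet X) :=
    rectHull_mono hsub ⟨z, hz⟩ hPb
  set L := (List.finRange s).filter (· ∈ u) with hL
  set δ : Fin s → ℝ := fun j => C * (b : ℝ) ^ (-((extendZero u κ j : ℝ) / (d : ℝ))) with hδ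
  set T := (touching d u).filter (fun v => v.card = u.card) with hT
  set A := fun v => ⨆ y ∈ rectHull (cellProd S u κ τ),
    ENNReal.ofReal |mixedPartial (rectHull (prodSet X)) e v y| with hA
  have hδ0 : ∀ j, 0 < δ j := fun j => mul_pos (by linarith) (Real.rpow_pos_of_pos hb0 _)
  obtain ⟨p', q', hpq'⟩ : ∃ p' q', rectHull (cellProd S u κ τ) = Icc p' q' :=
    ⟨_, _, rectHull_eq_Icc _⟩
  have hpt : ∀ y ∈ cellProd S u κ τ, ENNReal.ofReal |blockDiffs z L (G ∅) y| ≤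
      ENNReal.ofReal (∏ j ∈ u, δ j) * ∑ v ∈ T, A v := by
    intro y hy
    have h1 := hG.ofReal_abs_blockDiffs_le (e := e) (hpq ▸ he) ⟨0, hd⟩
      (hpq ▸ hpq' ▸ hmono) (hpq' ▸ hhull hz) (hpq' ▸ hhull hy)
      u δ hδ0 (by
        rintro ⟨j, i⟩ hj
        simp only at hj
        have h2 := hy j
        have h3 := hz j
        simp only [hj, dif_pos] at h2 h3
        have h4 := abs_coord_sub_le_diam ((hXb j).subset
          ((S j).cell_subset hb _ _ (τ ⟨j, hj⟩).2)) h2 h3 i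
        have h5 := hdiam j _ _ (τ ⟨j, hj⟩).2
        refine h4.trans (h5.trans (le_of_eq ?_))
        simp [hδ, extendZero, hj])
    rw [← hpq', ← hpq] at h1
    exact h1
  have hint := (integral_blockDiffs_mul hXm hXv (blockHaar S u κ τ γ)
    (measurable_blockHaar S u κ τ γ hXm) (bounded_blockHaar S u κ τ γ) z L
    (fun j hj => setIntegral_blockHaar S u κ τ γ hb hXv (by simpa [hL] using hj)) (G ∅)
    (hG.measurable ∅) (hG.bounded.imp fun M h x => h _ x)).2
  simp_rw [multiHaar_eq_prod]
  rw [← hint]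
  simp_rw [← multiHaar_eq_prod]
  have hψm : Measurable (multiHaar S u κ τ γ) := by
    simp_rw [funext (multiHaar_eq_prod S u κ τ γ)]
    exact Finset.measurable_prod _ fun j _ => (measurable_blockHaar S u κ τ γ hXm j).comp
      ((measurable_pi_apply j).comp (componentEquiv (Fin s) d).measurable)
  have hψi : Integrable (fun x => |multiHaar S u κ τ γ x|) (volume.restrict (prodSet X)) := by
    have := isProbabilityMeasure_prodSet hXm hXv
    choose N hN using bounded_blockHaar S u κ τ γ
    refine Integrable.of_bound (C := ∏ i, N i) (measurable_abs.comp hψm).aestronglyMeasurable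
      (Filter.Eventually.of_forall fun x => ?_)
    rw [Real.norm_eq_abs, abs_abs, multiHaar_eq_prod, Finset.abs_prod]
    exact Finset.prod_le_prod (fun _ _ => abs_nonneg _) fun i _ => hN i _
  calc ENNReal.ofReal |∫ x in prodSet X, blockDiffs z L (G ∅) x * multiHaar S u κ τ γ x|
      ≤ ∫⁻ x in prodSet X, ‖blockDiffs z L (G ∅) x * multiHaar S u κ τ γ x‖ₑ := by
        rw [← Real.enorm_eq_ofReal_abs]
        exact enorm_integral_le_lintegral_enorm _
    _ ≤ ∫⁻ x in prodSet X, (ENNReal.ofReal (∏ j ∈ u, δ j) * ∑ v ∈ T, A v) *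
          ENNReal.ofReal |multiHaar S u κ τ γ x| := by
        refine lintegral_mono fun x => ?_
        rw [enorm_mul, Real.enorm_eq_ofReal_abs, Real.enorm_eq_ofReal_abs]
        by_cases hx : x ∈ cellProd S u κ τ
        · exact mul_le_mul_left (hpt x hx) _
        · simp [multiHaar_eq_zero S u κ τ γ hx]
    _ = (ENNReal.ofReal (∏ j ∈ u, δ j) * ∑ v ∈ T, A v) *
          ENNReal.ofReal (∫ x in prodSet X, |multiHaar S u κ τ γ x|) := by
        rw [lintegral_const_mul _ (f := fun x => ENNReal.ofReal |multiHaar S u κ τ γ x|)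
          (measurable_abs.comp hψm).ennreal_ofReal,
          ofReal_integral_eq_lintegral_ofReal hψi
            (Filter.Eventually.of_forall fun x => abs_nonneg _)]
    _ = ENNReal.ofReal ((2 - 2 / (b : ℝ)) ^ u.card *
          (b : ℝ) ^ (-(((∑ j, κ j : ℕ) : ℝ) / 2 * (1 + 2 / (d : ℝ))) - (u.card : ℝ) / 2)) *
          ∑ v ∈ T, ENNReal.ofReal (C ^ u.card) * A v := by
        have h0 : 0 ≤ ∏ j ∈ u, δ j := Finset.prod_nonneg fun j _ => (hδ0 j).le
        have hb1 : 2 / (b : ℝ) ≤ 2 := by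
          rw [div_le_iff₀ hb0]
          have : (2 : ℝ) ≤ b := by exact_mod_cast hb
          linarith
        rw [setIntegral_abs_multiHaar S u κ τ γ hb hXm hXv, mul_right_comm,
          ← ENNReal.ofReal_mul h0, coefficient_eq u κ hb C, ENNReal.ofReal_mul, mul_assoc,
          Finset.mul_sum]
        exact mul_nonneg (pow_nonneg (by linarith) _) (Real.rpow_nonneg hb0.le _)
    _ ≤ coefficientBound S C u κ τ e := by
        rw [coefficientBound]
        refine mul_le_mul_right ?_ _
        refine le_trans (Finset.sum_le_sum fun v hv => mul_le_mul_left ?_ _)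
          (Finset.sum_le_sum_of_subset (Finset.filter_subset _ _))
        rw [(Finset.mem_filter.1 hv).2]
        refine ENNReal.ofReal_le_ofReal (le_mul_of_one_le_left (by positivity) ?_)
        exact Real.one_le_rpow (by exact_mod_cast hd) (by positivity)

end Bound

/-! ### Integrals of ANOVA components -/

section Anova

variable {s d b : ℕ} {X : Fin s → Set (EuclideanSpace ℝ (Fin d))}

theorem anova_eq (X : Fin s → Set (EuclideanSpace ℝ (Fin d))) (f : (Fin s × Fin d → ℝ) → ℝ)
    (u : Finset (Fin s)) :
    anova X f u = integralOut X u (fun x => f x - ∑ v ∈ u.ssubsets, anova X f v x) := by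
  rw [anova]
  congr 1
  funext x
  rw [← Finset.sum_attach u.ssubsets (fun v => anova X f v x)]

theorem glue_congr {u : Finset (Fin s)} {x x' : Fin s × Fin d → ℝ}
    (h : ∀ p, p.1 ∈ u → x p = x' p) : glue u x = glue u x' := by
  funext y p
  by_cases hp : p.1 ∈ u <;> simp [glue, hp, h]

theorem integralOut_congr {u : Finset (Fin s)} {x x' : Fin s × Fin d → ℝ}
    (h : ∀ p, p.1 ∈ u → x p = x' p) (g : (Fin s × Fin d → ℝ) → ℝ) :
    integralOut X u g x = integralOut X u g x' := by
  rw [integralOut, glue_congr h, integralOut]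

theorem integralOut_replaceBlock {u : Finset (Fin s)} {j : Fin s} (hj : j ∉ u)
    (g : (Fin s × Fin d → ℝ) → ℝ) (x y : Fin s × Fin d → ℝ) :
    integralOut X u g (replaceBlock y j x) = integralOut X u g x := by
  refine integralOut_congr (fun p hp => ?_) g
  have : p.1 ≠ j := fun h => hj (h ▸ hp)
  simp [replaceBlock, this]

theorem integrable_integralOut (hX : ∀ j, MeasurableSet (X j)) (hv : ∀ j, volume (X j) = 1)
    (u : Finset (Fin s)) {g : (Fin s × Fin d → ℝ) → ℝ} (hg : IntegrableOn g (prodSet X)) :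
    IntegrableOn (integralOut X u g) (prodSet X) := by
  have h := (measurePreserving_glue hX hv u).integrable_comp_of_integrable hg
  exact h.integral_prod_left

theorem integral_integralOut_mul (hX : ∀ j, MeasurableSet (X j)) (hv : ∀ j, volume (X j) = 1)
    (u : Finset (Fin s)) {g ψ : (Fin s × Fin d → ℝ) → ℝ}
    (hψ : ∀ x ∈ prodSet X, ∀ y ∈ prodSet fun j : {j : Fin s // j ∉ u} => X j.1,
      ψ (glue u x y) = ψ x)
    (hi : IntegrableOn (fun x => g x * ψ x) (prodSet X)) :
    ∫ x in prodSet X, integralOut X u g x * ψ x = ∫ x in prodSet X, g x * ψ x := by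
  have hmp := measurePreserving_glue hX hv u
  have hi2 := hmp.integrable_comp_of_integrable hi
  have h0 := hi.aestronglyMeasurable
  rw [← hmp.map_eq] at h0
  have e1 : ∫ x in prodSet X, g x * ψ x =
      ∫ q, g (glue u q.1 q.2) * ψ (glue u q.1 q.2) ∂((volume.restrict (prodSet X)).prod
        (volume.restrict (prodSet fun j : {j : Fin s // j ∉ u} => X j.1))) := by
    conv_lhs => rw [← hmp.map_eq]
    exact integral_map hmp.measurable.aemeasurable h0
  rw [e1, integral_prod (fun q : _ × _ => g (glue u q.1 q.2) * ψ (glue u q.1 q.2)) hi2]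
  refine setIntegral_congr_fun (measurableSet_prodSet hX) fun x hx => ?_
  simp only [integralOut]
  rw [← integral_mul_const]
  refine setIntegral_congr_fun (measurableSet_prodSet fun j => hX j.1) fun y hy => ?_
  rw [hψ x hx y hy]

theorem integrable_anova (hX : ∀ j, MeasurableSet (X j)) (hv : ∀ j, volume (X j) = 1)
    {f : (Fin s × Fin d → ℝ) → ℝ} (hf : IntegrableOn f (prodSet X)) (u : Finset (Fin s)) :
    IntegrableOn (anova X f u) (prodSet X) := by
  induction u using Finset.strongInduction with
  | H u ih =>
    rw [anova_eq]
    refine integrable_integralOut hX hv u (hf.sub ?_)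
    exact integrable_finsetSum _ fun v hv => ih v (Finset.mem_ssubsets.1 hv)

theorem multiHaar_glue (S : ∀ j, RecursiveSplit b (X j)) (u : Finset (Fin s)) (κ : u → ℕ)
    (τ : ∀ j : u, Fin (b ^ κ j)) (γ : u → Fin b) {x : Fin s × Fin d → ℝ} (hx : x ∈ prodSet X)
    {y : {j : Fin s // j ∉ u} × Fin d → ℝ}
    (hy : y ∈ prodSet fun j : {j : Fin s // j ∉ u} => X j.1) :
    multiHaar S u κ τ γ (glue u x y) = multiHaar S u κ τ γ x := by
  rw [multiHaar_eq_prod, multiHaar_eq_prod]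
  refine Finset.prod_congr rfl fun j _ => ?_
  by_cases h : j ∈ u
  · have e : component (glue u x y) j = component x j := by
      ext i; simp [component, glue, h]
    rw [e]
  · have e : component (glue u x y) j = component y ⟨j, h⟩ := by
      ext i; simp [component, glue, h]
    have h1 : component y ⟨j, h⟩ ∈ X j := hy ⟨j, h⟩
    simp [blockHaar, h, e, h1, hx j]

theorem integrable_mul_multiHaar (S : ∀ j, RecursiveSplit b (X j)) (u : Finset (Fin s))
    (κ : u → ℕ) (τ : ∀ j : u, Fin (b ^ κ j)) (γ : u → Fin b) (hX : ∀ j, MeasurableSet (X j))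
    {g : (Fin s × Fin d → ℝ) → ℝ} (hg : IntegrableOn g (prodSet X)) :
    IntegrableOn (fun x => g x * multiHaar S u κ τ γ x) (prodSet X) := by
  choose N hN using bounded_blockHaar S u κ τ γ
  have hψm : Measurable (multiHaar S u κ τ γ) := by
    simp_rw [funext (multiHaar_eq_prod S u κ τ γ)]
    exact Finset.measurable_prod _ fun j _ => (measurable_blockHaar S u κ τ γ hX j).comp
      ((measurable_pi_apply j).comp (componentEquiv (Fin s) d).measurable)
  refine Integrable.mul_bdd (c := ∏ i, N i) hg hψm.aestronglyMeasurable
    (Filter.Eventually.of_forall fun x => ?_)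
  rw [Real.norm_eq_abs, multiHaar_eq_prod, Finset.abs_prod]
  exact Finset.prod_le_prod (fun _ _ => abs_nonneg _) fun i _ => hN i _

/-- The inner products of `f` and of its ANOVA component `f_u` with `ψ_{uκτγ}` agree. -/
theorem innerProd_anova (S : ∀ j, RecursiveSplit b (X j)) (u : Finset (Fin s)) (κ : u → ℕ)
    (τ : ∀ j : u, Fin (b ^ κ j)) (γ : u → Fin b) (hb : 2 ≤ b) (hX : ∀ j, MeasurableSet (X j))
    (hv : ∀ j, volume (X j) = 1) {f : (Fin s × Fin d → ℝ) → ℝ}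
    (hf : IntegrableOn f (prodSet X)) :
    innerProd X (anova X f u) (multiHaar S u κ τ γ) = innerProd X f (multiHaar S u κ τ γ) := by
  have hi := fun v => integrable_anova hX hv hf v
  have hz : ∀ v ∈ u.ssubsets, ∫ x in prodSet X, anova X f v x * multiHaar S u κ τ γ x = 0 := by
    intro v hvu
    obtain ⟨j, hju, hjv⟩ := Finset.exists_of_ssubset (Finset.mem_ssubsets.1 hvu)
    simp_rw [multiHaar_eq_prod]
    refine integral_mul_prod_eq_zero hX hv _ j (measurable_blockHaar S u κ τ γ hX j)
      (setIntegral_blockHaar S u κ τ γ hb hv hju) _ fun x y => ?_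
    rw [anova_eq, integralOut_replaceBlock hjv]
  have hs : IntegrableOn (fun x => ∑ v ∈ u.ssubsets, anova X f v x) (prodSet X) :=
    integrable_finsetSum _ fun v _ => hi v
  rw [innerProd, innerProd, anova_eq, integral_integralOut_mul hX hv u]
  · simp_rw [sub_mul, Finset.sum_mul]
    rw [integral_sub (integrable_mul_multiHaar S u κ τ γ hX hf)
      (integrable_finsetSum _ fun v _ => integrable_mul_multiHaar S u κ τ γ hX (hi v)),
      integral_finsetSum _ fun v _ => integrable_mul_multiHaar S u κ τ γ hX (hi v),
      Finset.sum_eq_zero hz, sub_zero]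
  · intro x hx y hy
    exact multiHaar_glue S u κ τ γ hx hy
  · exact integrable_mul_multiHaar S u κ τ γ hX (hf.sub hs)

end Anova

/-! ### Primitives along segments -/

section Partial

variable {ι : Type*} [Fintype ι] [DecidableEq ι]

theorem hasDerivWithinAt_update {D : Set (ι → ℝ)} {F F' : (ι → ℝ) → ℝ} {l : ι}
    (h : ∀ x ∈ D, HasPartialWithinAt D F l x (F' x)) {x : ι → ℝ} {r : ℝ} (hr : r ∈ slice D x l) :
    HasDerivWithinAt (fun r => F (Function.update x l r)) (F' (Function.update x l r))
      (slice D x l) r := by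
  have h1 := h _ hr
  simpa [HasPartialWithinAt, slice] using h1

theorem continuous_update_right (x : ι → ℝ) (l : ι) : Continuous fun r => Function.update x l r :=
  continuous_const.update l continuous_id

theorem partial_sub_eq {D : Set (ι → ℝ)} {F F' : (ι → ℝ) → ℝ} {l : ι} {x : ι → ℝ} {z : ℝ}
    (hseg : ∀ r ∈ uIcc z (x l), Function.update x l r ∈ D) (hF' : ContinuousOn F' D)
    (h : ∀ x ∈ D, HasPartialWithinAt D F l x (F' x)) :
    F x - F (Function.update x l z) = ∫ r in z..x l, F' (Function.update x l r) := by
  have hd : ∀ r ∈ uIcc z (x l), HasDerivWithinAt (fun r => F (Function.update x l r))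
      (F' (Function.update x l r)) (uIcc z (x l)) r := fun r hr =>
    (hasDerivWithinAt_update h (hseg r hr)).mono hseg
  have hc : ContinuousOn (fun r => F' (Function.update x l r)) (uIcc z (x l)) :=
    hF'.comp (continuous_update_right x l).continuousOn hseg
  have h1 := intervalIntegral.integral_eq_sub_of_hasDeriv_right
    (f := fun r => F (Function.update x l r)) (f' := fun r => F' (Function.update x l r))
    (fun r hr => (hd r hr).continuousWithinAt) (fun r hr =>
      ((hd r (Ioo_subset_Icc_self hr)).hasDerivAt (Icc_mem_nhds hr.1 hr.2)).hasDerivWithinAt)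
    hc.intervalIntegrable
  rw [h1, Function.update_eq_self]

theorem measurable_indicator_of_continuousOn {D : Set (ι → ℝ)} (hD : MeasurableSet D)
    {F : (ι → ℝ) → ℝ} (hF : ContinuousOn F D) : Measurable (D.indicator F) := by
  classical
  rw [← Set.piecewise_eq_indicator]
  exact hF.measurable_piecewise continuousOn_const hD

theorem bounded_indicator_of_continuousOn {D : Set (ι → ℝ)} (hD : IsCompact D)
    {F : Finset ι → (ι → ℝ) → ℝ} (hF : ∀ P, ContinuousOn (F P) D) :
    ∃ M, ∀ P x, |D.indicator (F P) x| ≤ M := by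
  choose M hM using fun P => hD.exists_bound_of_continuousOn (hF P)
  refine ⟨∑ P, |M P|, fun P x => ?_⟩
  have h1 : |M P| ≤ ∑ P, |M P| :=
    Finset.single_le_sum (f := fun P => |M P|) (fun _ _ => abs_nonneg _) (Finset.mem_univ P)
  by_cases hx : x ∈ D
  · rw [indicator_of_mem hx]
    exact (hM P x hx).trans ((le_abs_self _).trans h1)
  · rw [indicator_of_notMem hx, abs_zero]
    exact (abs_nonneg _).trans h1

theorem weakMixedFamily_of_hasPartialWithinAt {p q : ι → ℝ} {F : Finset ι → (ι → ℝ) → ℝ}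
    (hc : ∀ P, ContinuousOn (F P) (Icc p q))
    (h : ∀ P, ∀ l ∉ P, ∀ x ∈ Icc p q,
      HasPartialWithinAt (Icc p q) (F P) l x (F (insert l P) x)) :
    WeakMixedFamily p q (fun P => (Icc p q).indicator (F P)) where
  measurable P := measurable_indicator_of_continuousOn measurableSet_Icc (hc P)
  bounded := bounded_indicator_of_continuousOn isCompact_Icc hc
  zero P x hx := indicator_of_notMem hx _
  sub_eq P l hl x hx z hz := by
    have hseg : ∀ r ∈ uIcc z (x l), Function.update x l r ∈ Icc p q := fun r hr =>
      update_mem_Icc hx (uIcc_subset_Icc hz ⟨hx.1 l, hx.2 l⟩ hr)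
    rw [indicator_of_mem hx, indicator_of_mem (update_mem_Icc hx hz),
      partial_sub_eq hseg (hc _) (h P l hl)]
    exact intervalIntegral.integral_congr fun r hr => (indicator_of_mem (hseg r hr) _).symm

end Partial

/-! ### The bound for Whitney extensions -/

section Whitney

variable {s d b : ℕ} {X : Fin s → Set (EuclideanSpace ℝ (Fin d))}

theorem measurableSet_region (S : ∀ j, RecursiveSplit b (X j)) (j : Fin s) :
    MeasurableSet (X j) := by
  have := (S j).measurableSet_cell 0 0 (by simp)
  rwa [(S j).cell_zero] at this

theorem isCompact_prodSet (hX : ∀ j, Bornology.IsBounded (X j)) (hc : IsClosed (prodSet X)) :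
    IsCompact (prodSet X) :=
  Metric.isCompact_of_isClosed_isBounded hc (isBounded_prodSet hX)

theorem isClosed_prodSet (hX : ∀ j, IsClosed (X j)) : IsClosed (prodSet X) := by
  have : prodSet X = ⋂ j, (fun x => component x j) ⁻¹' X j := by
    ext x; simp [prodSet]
  rw [this]
  refine isClosed_iInter fun j => (hX j).preimage ?_
  exact (PiLp.continuous_toLp 2 _).comp (continuous_pi fun i => continuous_apply (j, i))

theorem coefficient_le_whitney (hd : 0 < d) (hb : 2 ≤ b)
    (hXb : ∀ j, Bornology.IsBounded (X j)) (hXv : ∀ j, volume (X j) = 1)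
    (S : ∀ j, RecursiveSplit b (X j)) {C : ℝ} (hC : 1 ≤ C)
    (hdiam : ∀ j k t, t < b ^ k →
      Metric.diam ((S j).cell k t) ≤ C * (b : ℝ) ^ (-((k : ℝ) / (d : ℝ))))
    (f : (Fin s × Fin d → ℝ) → ℝ) (u : Finset (Fin s)) (κ : u → ℕ)
    (τ : ∀ j : u, Fin (b ^ κ j)) (γ : u → Fin b) (hXc : ∀ j, IsClosed (X j))
    (hf : InCm (prodSet X) (d * s) f) (e : (Fin s × Fin d → ℝ) → ℝ)
    (he : IsWhitneyExtension (prodSet X) (d * s) (anova X f u) e) :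
    ENNReal.ofReal |innerProd X f (multiHaar S u κ τ γ)| ≤ coefficientBound S C u κ τ e := by
  have hXm := measurableSet_region S
  have hK := isCompact_prodSet hXb (isClosed_prodSet hXc)
  have hfi : IntegrableOn f (prodSet X) := by
    obtain ⟨G, hG0, hGc, -⟩ := hf
    exact ((hGc 0 (by simp)).congr hG0.symm).integrableOn_compact hK
  obtain ⟨⟨G, E, hG, hE, hGE⟩, -⟩ := he
  obtain ⟨p, q, hpq⟩ : ∃ p q, rectHull (prodSet X) = Icc p q := ⟨_, _, rectHull_eq_Icc _⟩
  have hsub := subset_rectHull (isBounded_prodSet hXb)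
  let F : Finset (Fin s × Fin d) → (Fin s × Fin d → ℝ) → ℝ :=
    fun P => E (fun i => if i ∈ P then 1 else 0)
  have hcard : Fintype.card (Fin s × Fin d) = d * s := by simp [mul_comm]
  have hsum : ∀ P : Finset (Fin s × Fin d), ∑ i, (if i ∈ P then 1 else 0 : ℕ) = P.card := by
    intro P; simp
  have hfam : WeakMixedFamily p q (fun P => (Icc p q).indicator (F P)) := by
    refine weakMixedFamily_of_hasPartialWithinAt (fun P => ?_) (fun P l hl x hx => ?_)
    · rw [← hpq]
      exact hE.2.1 _ (by rw [hsum, ← hcard]; exact Finset.card_le_univ P)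
    · rw [← hpq] at hx ⊢
      have h1 := hE.2.2 (fun i => if i ∈ P then 1 else 0) l (by
        rw [hsum, ← hcard]
        exact Finset.card_lt_univ_of_notMem hl) x hx
      have e1 : (fun i => if i ∈ P then 1 else 0 : Fin s × Fin d → ℕ) + Pi.single l 1 =
          fun i => if i ∈ insert l P then 1 else 0 := by
        funext i
        by_cases hi : i = l
        · subst hi; simp [hl]
        · simp [hi]
      rw [e1] at h1
      exact h1
  have e0 : F ∅ = E 0 := by
    simp only [F]
    congr 1
  have heF : EqOn e ((Icc p q).indicator (F ∅)) (rectHull (prodSet X)) := by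
    intro x hx
    rw [indicator_of_mem (hpq ▸ hx), e0, hE.1 hx]
  have key := hfam.coefficient_le S u κ τ γ hd hb hXm hXb hXv hC hdiam hpq heF
  rw [← innerProd_anova S u κ τ γ hb hXm hXv hfi, innerProd]
  convert key using 3
  refine setIntegral_congr_fun (measurableSet_prodSet hXm) fun x hx => ?_
  rw [← heF (hsub hx), ← hE.1 (hsub hx), hGE 0 (by simp) hx, hG.1 hx]

end Whitney

/-! ### Smoothness of ANOVA components -/

section Smooth

theorem SmoothOn.sub {ι : Type*} [DecidableEq ι] {D : Set (ι → ℝ)} {g h : (ι → ℝ) → ℝ}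
    (hg : SmoothOn D g) (hh : SmoothOn D h) : SmoothOn D (fun x => g x - h x) := by
  obtain ⟨F, h1, h2, h3⟩ := hg
  obtain ⟨F', h1', h2', h3'⟩ := hh
  refine ⟨fun v x => F v x - F' v x, fun x hx => ?_, fun v => (h2 v).sub (h2' v),
    fun v l hl x hx => (h3 v l hl x hx).sub (h3' v l hl x hx)⟩
  simp only [h1 hx, h1' hx]

theorem SmoothOn.sum {ι κ : Type*} [DecidableEq ι] {D : Set (ι → ℝ)} (T : Finset κ)
    {g : κ → (ι → ℝ) → ℝ} (hg : ∀ k ∈ T, SmoothOn D (g k)) :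
    SmoothOn D (fun x => ∑ k ∈ T, g k x) := by
  classical
  have hg' : ∀ k, ∃ F : Finset ι → (ι → ℝ) → ℝ, k ∈ T → (EqOn (F ∅) (g k) D ∧
      (∀ v, ContinuousOn (F v) D) ∧
      ∀ v, ∀ l ∉ v, ∀ x ∈ D, HasPartialWithinAt D (F v) l x (F (insert l v) x)) := by
    intro k
    by_cases hk : k ∈ T
    · obtain ⟨F, hF⟩ := hg k hk; exact ⟨F, fun _ => hF⟩
    · exact ⟨0, fun h => (hk h).elim⟩
  choose F hF using hg'
  refine ⟨fun v x => ∑ k ∈ T, F k v x, fun x hx => ?_, fun v => ?_, fun v l hl x hx => ?_⟩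
  · exact Finset.sum_congr rfl fun k hk => (hF k hk).1 hx
  · exact continuousOn_finsetSum _ fun k hk => (hF k hk).2.1 v
  · exact HasDerivWithinAt.fun_sum fun k hk => (hF k hk).2.2 v l hl x hx

theorem hasDerivWithinAt_integral_of_bounded {α : Type*} [MeasurableSpace α] {μ : Measure α}
    [IsFiniteMeasure μ] {I : Set ℝ} (hI : Convex ℝ I) {φ φ' : ℝ → α → ℝ} {r₀ : ℝ}
    (hr₀ : r₀ ∈ I) (hφ : ∀ r ∈ I, Integrable (φ r) μ) (M : ℝ)
    (hd : ∀ᵐ y ∂μ, ∀ r ∈ I, HasDerivWithinAt (fun r => φ r y) (φ' r y) I r ∧ |φ' r y| ≤ M) :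
    HasDerivWithinAt (fun r => ∫ y, φ r y ∂μ) (∫ y, φ' r₀ y ∂μ) I r₀ := by
  rw [hasDerivWithinAt_iff_tendsto_slope]
  have hev : ∀ᶠ r in 𝓝[I \ {r₀}] r₀, r ∈ I := by
    filter_upwards [self_mem_nhdsWithin] with r hr using hr.1
  have h1 : Filter.Tendsto (fun r => ∫ y, slope (fun r => φ r y) r₀ r ∂μ) (𝓝[I \ {r₀}] r₀)
      (𝓝 (∫ y, φ' r₀ y ∂μ)) := by
    refine tendsto_integral_filter_of_dominated_convergence (fun _ => M) ?_ ?_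
      (integrable_const M) ?_
    · filter_upwards [hev] with r hr
      simp only [slope_def_field]
      exact (((hφ r hr).sub (hφ r₀ hr₀)).div_const _).aestronglyMeasurable
    · filter_upwards [self_mem_nhdsWithin] with r hr
      filter_upwards [hd] with y hy
      have h2 := hI.norm_image_sub_le_of_norm_hasDerivWithin_le
        (f := fun r => φ r y) (f' := fun r => φ' r y) (C := M)
        (fun r hr => (hy r hr).1) (fun r hr => (hy r hr).2) hr₀ hr.1
      have h3 : 0 < ‖r - r₀‖ := norm_pos_iff.2 (sub_ne_zero.2 hr.2)
      rw [slope_def_field, norm_div, div_le_iff₀ h3]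
      exact h2
    · filter_upwards [hd] with y hy
      exact hasDerivWithinAt_iff_tendsto_slope.1 (hy r₀ hr₀).1
  refine h1.congr' ?_
  filter_upwards [hev] with r hr
  simp only [slope_def_field]
  rw [integral_div, integral_sub (hφ r hr) (hφ r₀ hr₀)]

theorem IsSobolExtensible.update_mem {ι : Type*} [DecidableEq ι] {D : Set (ι → ℝ)} {c : ι → ℝ}
    (hD : IsSobolExtensible D c) {x : ι → ℝ} (hx : x ∈ D) {l : ι} {r : ℝ}
    (hr : r ∈ uIcc (c l) (x l)) : Function.update x l r ∈ D := by
  refine hD.box_subset x hx ⟨fun m => ?_, fun m => ?_⟩ <;> by_cases h : m = l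
  · subst h; simpa using hr.1
  · simp [h]
  · subst h; simpa using hr.2
  · simp [h]

theorem IsSobolExtensible.convex_slice {ι : Type*} [DecidableEq ι] {D : Set (ι → ℝ)}
    {c : ι → ℝ} (hD : IsSobolExtensible D c) (x : ι → ℝ) (l : ι) : Convex ℝ (slice D x l) := by
  have h : ∀ r ∈ slice D x l, uIcc (c l) r ⊆ slice D x l := by
    intro r hr t ht
    have := hD.update_mem (l := l) (r := t) hr (by simpa using ht)
    simpa [slice] using this
  rw [convex_iff_ordConnected]
  refine ⟨fun r hr r' hr' t ht => ?_⟩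
  rcases le_total t (c l) with htc | htc
  · exact h r hr ⟨inf_le_right.trans ht.1, htc.trans le_sup_left⟩
  · exact h r' hr' ⟨inf_le_left.trans htc, ht.2.trans le_sup_right⟩

variable {s d : ℕ} {X : Fin s → Set (EuclideanSpace ℝ (Fin d))}

theorem glue_mem {u : Finset (Fin s)} {x : Fin s × Fin d → ℝ} (hx : x ∈ prodSet X)
    {y : {j : Fin s // j ∉ u} × Fin d → ℝ}
    (hy : y ∈ prodSet fun j : {j : Fin s // j ∉ u} => X j.1) : glue u x y ∈ prodSet X := by
  intro j
  by_cases h : j ∈ u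
  · have e : component (glue u x y) j = component x j := by
      ext i; simp [component, glue, h]
    rw [e]; exact hx j
  · have e : component (glue u x y) j = component y ⟨j, h⟩ := by
      ext i; simp [component, glue, h]
    rw [e]; exact hy ⟨j, h⟩

theorem mem_of_glue_mem {u : Finset (Fin s)} {x z : Fin s × Fin d → ℝ} (hz : z ∈ prodSet X)
    (hxz : ∀ p, p.1 ∉ u → x p = z p) {y : {j : Fin s // j ∉ u} × Fin d → ℝ}
    (h : glue u x y ∈ prodSet X) : x ∈ prodSet X := by
  intro j
  by_cases hj : j ∈ u
  · have e : component (glue u x y) j = component x j := by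
      ext i; simp [component, glue, hj]
    rw [← e]; exact h j
  · have e : component x j = component z j := by
      ext i; simp [component, hxz (j, i) hj]
    rw [e]; exact hz j

theorem glue_update {u : Finset (Fin s)} {l : Fin s × Fin d} (hl : l.1 ∈ u)
    (x : Fin s × Fin d → ℝ) (r : ℝ) (y : {j : Fin s // j ∉ u} × Fin d → ℝ) :
    glue u (Function.update x l r) y = Function.update (glue u x y) l r := by
  funext p
  by_cases hp : p = l
  · subst hp; simp [glue, hl]
  · by_cases hpu : p.1 ∈ u <;> simp [glue, hp, hpu]

theorem continuous_glue_left (u : Finset (Fin s)) (y : {j : Fin s // j ∉ u} × Fin d → ℝ) :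
    Continuous fun x : Fin s × Fin d → ℝ => glue u x y := by
  refine continuous_pi fun p => ?_
  by_cases hp : p.1 ∈ u
  · simpa [glue, hp] using continuous_apply p
  · simpa [glue, hp] using continuous_const

theorem continuous_glue_right (u : Finset (Fin s)) (x : Fin s × Fin d → ℝ) :
    Continuous fun y : {j : Fin s // j ∉ u} × Fin d → ℝ => glue u x y := by
  refine continuous_pi fun p => ?_
  by_cases hp : p.1 ∈ u
  · simpa [glue, hp] using continuous_const
  · simpa [glue, hp] using continuous_apply _

theorem SmoothOn.integralOut (hXm : ∀ j, MeasurableSet (X j))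
    (hXb : ∀ j, Bornology.IsBounded (X j)) (hXv : ∀ j, volume (X j) = 1)
    {c : Fin s × Fin d → ℝ} (hc : IsSobolExtensible (prodSet X) c) (u : Finset (Fin s))
    {g : (Fin s × Fin d → ℝ) → ℝ} (hg : SmoothOn (prodSet X) g) :
    SmoothOn (prodSet X) (integralOut X u g) := by
  classical
  have hK := isCompact_prodSet hXb hc.isClosed
  obtain ⟨F, hF0, hFc, hFd⟩ := hg
  have hYm : MeasurableSet (prodSet fun j : {j : Fin s // j ∉ u} => X j.1) :=
    measurableSet_prodSet fun j => hXm j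
  have hYp := isProbabilityMeasure_prodSet (X := fun j : {j : Fin s // j ∉ u} => X j.1)
    (fun j => hXm j) fun j => hXv j
  have hFi : ∀ v, ∀ x ∈ prodSet X, IntegrableOn (fun y => F v (glue u x y))
      (prodSet fun j : {j : Fin s // j ∉ u} => X j.1) := by
    intro v x hx
    obtain ⟨M, hM⟩ := hK.exists_bound_of_continuousOn (hFc v)
    refine Integrable.of_bound (C := M) ?_ ?_
    · exact ((hFc v).comp (continuous_glue_right u x).continuousOn
        fun y hy => glue_mem hx hy).aestronglyMeasurable hYm
    · filter_upwards [ae_restrict_mem hYm] with y hy using hM _ (glue_mem hx hy)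
  obtain ⟨H, hpos, hneg⟩ : ∃ H : Finset (Fin s × Fin d) → (Fin s × Fin d → ℝ) → ℝ,
      (∀ v, (∀ p ∈ v, p.1 ∈ u) → H v = _root_.integralOut X u (F v)) ∧
      ∀ v, (¬ ∀ p ∈ v, p.1 ∈ u) → H v = 0 :=
    ⟨fun v => if ∀ p ∈ v, p.1 ∈ u then _root_.integralOut X u (F v) else 0,
      fun v hv => if_pos hv, fun v hv => if_neg hv⟩
  refine ⟨H, fun x hx => ?_, fun v => ?_, fun v l hl x hx => ?_⟩
  · rw [hpos ∅ (by simp)]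
    exact setIntegral_congr_fun hYm fun y hy => hF0 (glue_mem hx hy)
  · by_cases hv : ∀ p ∈ v, p.1 ∈ u
    · rw [hpos v hv]
      obtain ⟨M, hM⟩ := hK.exists_bound_of_continuousOn (hFc v)
      refine continuousOn_of_dominated (bound := fun _ => M)
        (fun x hx => (hFi v x hx).aestronglyMeasurable) (fun x hx => ?_) (integrable_const M) ?_
      · filter_upwards [ae_restrict_mem hYm] with y hy using hM _ (glue_mem hx hy)
      · filter_upwards [ae_restrict_mem hYm] with y hy
        exact (hFc v).comp (continuous_glue_left u y).continuousOn fun x hx => glue_mem hx hy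
    · rw [hneg v hv]
      exact continuousOn_const
  · by_cases hv : ∀ p ∈ v, p.1 ∈ u
    · by_cases hlu : l.1 ∈ u
      · have hvl : ∀ p ∈ insert l v, p.1 ∈ u := by
          intro p hp
          rcases Finset.mem_insert.1 hp with rfl | h
          exacts [hlu, hv p h]
        obtain ⟨M, hM⟩ := hK.exists_bound_of_continuousOn (hFc (insert l v))
        rw [hpos v hv, hpos _ hvl, HasPartialWithinAt]
        have h1 := hasDerivWithinAt_integral_of_bounded
          (μ := volume.restrict (prodSet fun j : {j : Fin s // j ∉ u} => X j.1))
          (hc.convex_slice x l) (r₀ := x l)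
          (φ := fun r y => F v (glue u (Function.update x l r) y))
          (φ' := fun r y => F (insert l v) (glue u (Function.update x l r) y))
          (by simpa [slice] using hx) (fun r hr => hFi v _ hr) M (by
            filter_upwards [ae_restrict_mem hYm] with y hy r hr
            refine ⟨?_, hM _ (glue_mem hr hy)⟩
            simp only [glue_update hlu]
            have e : slice (prodSet X) (glue u x y) l = slice (prodSet X) x l := by
              ext t
              simp only [slice, mem_ofPred_eq, ← glue_update hlu]
              refine ⟨fun h => mem_of_glue_mem hx (fun p hp => ?_) h, fun h => glue_mem h hy⟩
              rw [Function.update_of_ne]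
              rintro rfl
              exact hp hlu
            rw [← e]
            exact hasDerivWithinAt_update (hFd v l hl) (by rw [e]; exact hr))
        simp only [Function.update_eq_self] at h1
        exact h1
      · have hvl : ¬ ∀ p ∈ insert l v, p.1 ∈ u := fun h => hlu (h l (Finset.mem_insert_self _ _))
        rw [hpos v hv, hneg _ hvl, HasPartialWithinAt]
        have e : (fun r => _root_.integralOut X u (F v) (Function.update x l r)) =
            fun _ => _root_.integralOut X u (F v) x := by
          funext r
          refine integralOut_congr (fun p hp => ?_) _
          rw [Function.update_of_ne]
          rintro rfl
          exact hlu hp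
        rw [e]
        exact hasDerivWithinAt_const _ _ _
    · have hvl : ¬ ∀ p ∈ insert l v, p.1 ∈ u := fun h =>
        hv fun p hp => h p (Finset.mem_insert_of_mem hp)
      rw [hneg v hv, hneg _ hvl, HasPartialWithinAt]
      exact hasDerivWithinAt_const _ _ _

theorem SmoothOn.anova (hXm : ∀ j, MeasurableSet (X j))
    (hXb : ∀ j, Bornology.IsBounded (X j)) (hXv : ∀ j, volume (X j) = 1)
    {c : Fin s × Fin d → ℝ} (hc : IsSobolExtensible (prodSet X) c)
    {f : (Fin s × Fin d → ℝ) → ℝ} (hf : SmoothOn (prodSet X) f) (u : Finset (Fin s)) :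
    SmoothOn (prodSet X) (anova X f u) := by
  induction u using Finset.strongInduction with
  | H u ih =>
    rw [anova_eq]
    exact (hf.sub (SmoothOn.sum _ fun v hv => ih v (Finset.mem_ssubsets.1 hv))).integralOut
      hXm hXb hXv hc u

/-- The mixed partial derivative `∂^w g` is the one given by smoothness at the points `x` with
`x_l ≠ c_l` for all `l ∈ w`. -/
theorem IsSobolExtensible.mixedPartial_eq {D : Set (Fin s × Fin d → ℝ)}
    {c : Fin s × Fin d → ℝ} (hc : IsSobolExtensible D c) {g : (Fin s × Fin d → ℝ) → ℝ}
    {F : Finset (Fin s × Fin d) → (Fin s × Fin d → ℝ) → ℝ} (hF0 : EqOn (F ∅) g D)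
    (hFd : ∀ v, ∀ l ∉ v, ∀ x ∈ D, HasPartialWithinAt D (F v) l x (F (insert l v) x))
    (w : Finset (Fin s × Fin d)) {x : Fin s × Fin d → ℝ} (hx : x ∈ D)
    (hxc : ∀ l ∈ w, x l ≠ c l) : mixedPartial D g w x = F w x := by
  have key : ∀ L : List (Fin s × Fin d), L.Nodup → ∀ x ∈ D, (∀ l ∈ L, x l ≠ c l) →
      L.foldr (fun l h => partialWithin D l h) g x = F L.toFinset x := by
    intro L hL
    induction L with
    | nil => intro x hx _; exact (hF0 hx).symm
    | cons l L ih =>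
      intro x hx hxc
      rw [List.nodup_cons] at hL
      have h1 := hFd L.toFinset l (by simpa using hL.1) x hx
      rw [List.foldr_cons, partialWithin, List.toFinset_cons]
      have h2 : UniqueDiffWithinAt ℝ (slice D x l) (x l) := by
        have h3 : uIcc (c l) (x l) ⊆ slice D x l := fun r hr => hc.update_mem hx hr
        refine UniqueDiffWithinAt.mono ?_ h3
        exact uniqueDiffOn_Icc (inf_lt_sup.2 (hxc l (by simp)).symm) _ right_mem_uIcc
      have hmem : x l ∈ slice D x l := by simpa [slice] using hx
      refine HasDerivWithinAt.derivWithin (HasDerivWithinAt.congr_of_mem h1 (fun r hr => ?_) hmem) h2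
      refine ih hL.2 _ hr fun m hm => ?_
      rw [Function.update_of_ne]
      · exact hxc m (List.mem_cons_of_mem _ hm)
      · rintro rfl; exact hL.1 hm
  have hn : (List.finRange s ×ˢ List.finRange d).Nodup :=
    (List.nodup_finRange s).product (List.nodup_finRange d)
  rw [mixedPartial, key _ (hn.filter _) x hx]
  · congr 1
    ext p
    simp only [List.mem_toFinset, List.mem_filter, decide_eq_true_eq, and_iff_right_iff_imp]
    exact fun _ => List.mem_product.2 ⟨List.mem_finRange _, List.mem_finRange _⟩
  · intro l hl
    exact hxc l (by simpa using (List.mem_filter.1 hl).2)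

end Smooth

/-! ### Signed integrals over boxes -/

section Box

variable {ι : Type*} [Fintype ι] [DecidableEq ι]

theorem abs_signedBoxIntegral_le (w : Finset ι) (c x : ι → ℝ) (h : (w → ℝ) → ℝ) {M : ℝ}
    (hM : ∀ y, |h y| ≤ M) :
    |signedBoxIntegral w c x h| ≤ M * ∏ l ∈ w, |x l - c l| := by
  have hs : |∏ l ∈ w, if x l < c l then (-1 : ℝ) else 1| = 1 := by
    rw [Finset.abs_prod]
    refine Finset.prod_eq_one fun l _ => ?_
    split_ifs <;> simp
  have hv : (volume (uIcc (fun l : w => c l.1) (fun l : w => x l.1))) =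
      ∏ l : w, ENNReal.ofReal |x l - c l| := by
    rw [← pi_univ_uIcc, volume_pi_pi]
    exact Finset.prod_congr rfl fun l _ => Real.volume_interval
  have hfin : volume (uIcc (fun l : w => c l.1) (fun l : w => x l.1)) < ∞ := by
    rw [hv]; exact ENNReal.prod_lt_top fun _ _ => ENNReal.ofReal_lt_top
  rw [signedBoxIntegral, abs_mul, hs, one_mul]
  have h1 := norm_setIntegral_le_of_norm_le_const (f := h) (C := M) hfin fun y _ => hM y
  refine h1.trans (le_of_eq ?_)
  rw [measureReal_def, hv, ENNReal.toReal_prod, ← Finset.prod_coe_sort w]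
  congr 1
  exact Finset.prod_congr rfl fun l _ => ENNReal.toReal_ofReal (abs_nonneg _)

theorem measurable_hybrid (w : Finset ι) :
    Measurable fun q : (ι → ℝ) × (w → ℝ) => hybrid q.1 w q.2 := by
  refine measurable_pi_iff.2 fun l => ?_
  by_cases hl : l ∈ w
  · simp only [hybrid, hl, dif_pos]
    exact (measurable_pi_apply (⟨l, hl⟩ : w)).comp measurable_snd
  · simp only [hybrid, hl, dif_neg, not_false_eq_true]
    exact (measurable_pi_apply l).comp measurable_fst

theorem measurable_signedBoxIntegral (w : Finset ι) (c : ι → ℝ) {h : (ι → ℝ) → ℝ}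
    (hh : Measurable h) :
    Measurable fun x => signedBoxIntegral w c x (fun y => h (hybrid x w y)) := by
  simp only [signedBoxIntegral]
  refine Measurable.mul ?_ ?_
  · refine Finset.measurable_prod _ fun l _ => ?_
    exact Measurable.ite (measurableSet_lt (measurable_pi_apply l) measurable_const)
      measurable_const measurable_const
  · let A : Set ((ι → ℝ) × (w → ℝ)) := {q | ∀ l : w, q.2 l ∈ uIcc (c l) (q.1 l)}
    have hA : MeasurableSet A := by
      have : A = ⋂ l : w, {q | c l ⊓ q.1 l ≤ q.2 l} ∩ {q | q.2 l ≤ c l ⊔ q.1 l} := by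
        ext q; simp [A, uIcc, mem_Icc]
      rw [this]
      refine MeasurableSet.iInter fun l => ?_
      have h1 : Measurable fun q : (ι → ℝ) × (w → ℝ) => q.1 l :=
        (measurable_pi_apply l.1).comp measurable_fst
      have h2 : Measurable fun q : (ι → ℝ) × (w → ℝ) => q.2 l :=
        (measurable_pi_apply l).comp measurable_snd
      exact (measurableSet_le (measurable_const.inf h1) h2).inter
        (measurableSet_le h2 (measurable_const.sup h1))
    have e : ∀ x : ι → ℝ,
        ∫ y in uIcc (fun l : w => c l.1) (fun l : w => x l.1), h (hybrid x w y) =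
        ∫ y, A.indicator (fun q => h (hybrid q.1 w q.2)) (x, y) := by
      intro x
      rw [← integral_indicator (show MeasurableSet (uIcc (fun l : w => c l.1) _) from
        measurableSet_Icc)]
      congr 1
      funext y
      have : y ∈ uIcc (fun l : w => c l.1) (fun l : w => x l.1) ↔ (x, y) ∈ A := by
        rw [← pi_univ_uIcc, mem_univ_pi]
        exact Iff.rfl
      by_cases hy : (x, y) ∈ A
      · rw [indicator_of_mem hy, indicator_of_mem (this.2 hy)]
      · rw [indicator_of_notMem hy, indicator_of_notMem (fun h => hy (this.1 h))]
    simp_rw [e]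
    have hm : StronglyMeasurable (A.indicator fun q => h (hybrid q.1 w q.2)) :=
      ((hh.comp (measurable_hybrid w)).indicator hA).stronglyMeasurable
    exact (hm.integral_prod_right' (ν := volume)).measurable

/-- The point of `ℝ^(insert l w)` with the coordinate `r` at `l` and the other coordinates
those of `y`. -/
def insertCoord (l : ι) (w : Finset ι) (q : ℝ × (w → ℝ)) : ↥(insert l w : Finset ι) → ℝ :=
  fun m => if h : m.1 ∈ w then q.2 ⟨m.1, h⟩ else q.1

theorem measurePreserving_insertCoord {l : ι} {w : Finset ι} (hl : l ∉ w) :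
    MeasurePreserving (insertCoord l w) volume volume ∧
      ∀ B : ι → Set ℝ, insertCoord l w ⁻¹' (univ.pi fun m => B m.1) =
        B l ×ˢ (univ.pi fun m : w => B m.1) := by
  have hpre : ∀ B : ↥(insert l w : Finset ι) → Set ℝ,
      insertCoord l w ⁻¹' (univ.pi B) = B ⟨l, Finset.mem_insert_self l w⟩ ×ˢ
        (univ.pi fun m : w => B ⟨m.1, Finset.mem_insert_of_mem m.2⟩) := by
    intro B
    ext q
    simp only [mem_preimage, mem_univ_pi, mem_prod, insertCoord]
    constructor
    · intro h
      refine ⟨by simpa [hl] using h ⟨l, Finset.mem_insert_self l w⟩, fun m => ?_⟩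
      simpa using h ⟨m.1, Finset.mem_insert_of_mem m.2⟩
    · rintro ⟨h1, h2⟩ ⟨m, hm⟩
      by_cases hmw : m ∈ w
      · simpa [hmw] using h2 ⟨m, hmw⟩
      · obtain rfl : m = l := (Finset.mem_insert.1 hm).resolve_right hmw
        simpa [hmw] using h1
  have hm : Measurable (insertCoord l w) := by
    refine measurable_pi_iff.2 fun m => ?_
    by_cases hmw : m.1 ∈ w
    · simp only [insertCoord, hmw, dif_pos]
      exact (measurable_pi_apply (⟨m.1, hmw⟩ : w)).comp measurable_snd
    · simp only [insertCoord, hmw, dif_neg, not_false_eq_true]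
      exact measurable_fst
  refine ⟨⟨hm, (Measure.pi_eq fun B hB => ?_).symm⟩, fun B => hpre _⟩
  rw [Measure.map_apply hm (MeasurableSet.univ_pi hB), hpre, Measure.volume_eq_prod,
    Measure.prod_prod, volume_pi_pi]
  have e : ∀ B' : ι → ℝ≥0∞, ∏ m : (insert l w : Finset ι), B' m.1 = B' l * ∏ m : w, B' m.1 := by
    intro B'
    rw [Finset.prod_coe_sort, Finset.prod_coe_sort, Finset.prod_insert hl]
  have e2 := e fun m => if h : m ∈ insert l w then volume (B ⟨m, h⟩) else 0
  simp only [Finset.mem_insert_self, dif_pos, Finset.coe_mem, Finset.mem_insert, or_true] at e2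
  exact e2.symm

theorem hybrid_insertCoord {l : ι} {w : Finset ι} (hl : l ∉ w) (x : ι → ℝ)
    (q : ℝ × (w → ℝ)) :
    hybrid x (insert l w) (insertCoord l w q) = hybrid (Function.update x l q.1) w q.2 := by
  funext m
  by_cases hm : m ∈ w
  · simp [hybrid, insertCoord, hm]
  · by_cases hml : m = l
    · subst hml; simp [hybrid, insertCoord, hm]
    · simp [hybrid, hm, hml]

theorem signedBoxIntegral_update {w : Finset ι} {l : ι} (hl : l ∉ w) (c x : ι → ℝ) (r : ℝ)
    (h : (w → ℝ) → ℝ) :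
    signedBoxIntegral w c (Function.update x l r) h = signedBoxIntegral w c x h := by
  have hne : ∀ m ∈ w, Function.update x l r m = x m := by
    intro m hm
    rw [Function.update_of_ne]
    rintro rfl
    exact hl hm
  have e : (fun m : w => Function.update x l r m.1) = fun m : w => x m.1 :=
    funext fun m => hne m.1 m.2
  rw [signedBoxIntegral, signedBoxIntegral, e,
    Finset.prod_congr rfl fun m hm => by rw [hne m hm]]

theorem signedBoxIntegral_insert {w : Finset ι} {l : ι} (hl : l ∉ w) (c x : ι → ℝ)
    {h : (ι → ℝ) → ℝ} (hh : Measurable h) (hb : ∃ M, ∀ y, |h y| ≤ M) :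
    signedBoxIntegral (insert l w) c x (fun y => h (hybrid x (insert l w) y)) =
      ∫ r in c l..x l, signedBoxIntegral w c (Function.update x l r)
        (fun y => h (hybrid (Function.update x l r) w y)) := by
  obtain ⟨M, hM⟩ := hb
  obtain ⟨hmp, hpre⟩ := measurePreserving_insertCoord hl
  have hbox : insertCoord l w ⁻¹'
      (uIcc (fun m : (insert l w : Finset ι) => c m.1) (fun m => x m.1)) =
      uIcc (c l) (x l) ×ˢ uIcc (fun m : w => c m.1) (fun m => x m.1) := by
    rw [← pi_univ_uIcc, ← pi_univ_uIcc]
    exact hpre fun m => uIcc (c m) (x m)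
  have hmp2 := hmp.restrict_preimage (s := uIcc (fun m : (insert l w : Finset ι) => c m.1)
    (fun m => x m.1)) measurableSet_Icc
  have hmeas : Measurable fun y => h (hybrid x (insert l w) y) :=
    hh.comp ((measurable_hybrid _).comp measurable_prodMk_left)
  have e1 : ∫ y in uIcc (fun m : (insert l w : Finset ι) => c m.1) (fun m => x m.1),
      h (hybrid x (insert l w) y) =
      ∫ r in uIcc (c l) (x l), ∫ y in uIcc (fun m : w => c m.1) (fun m => x m.1),
        h (hybrid (Function.update x l r) w y) := by
    rw [← hmp2.map_eq, integral_map hmp2.measurable.aemeasurable hmeas.aestronglyMeasurable,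
      hbox, Measure.volume_eq_prod]
    simp_rw [hybrid_insertCoord hl]
    refine setIntegral_prod (fun q : ℝ × (w → ℝ) => h (hybrid (Function.update x l q.1) w q.2)) ?_
    refine Measure.integrableOn_of_bounded (M := M) ?_ ?_
      (Filter.Eventually.of_forall fun q => hM _)
    · rw [Measure.prod_prod]
      exact ENNReal.mul_ne_top isCompact_uIcc.measure_lt_top.ne
        (isCompact_Icc.measure_lt_top (μ := volume)).ne
    · have h2 : Measurable fun q : ℝ × (w → ℝ) => (Function.update x l q.1, q.2) :=
        ((measurable_update x).comp measurable_fst).prodMk measurable_snd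
      exact (hh.comp ((measurable_hybrid w).comp h2)).aestronglyMeasurable
  simp_rw [signedBoxIntegral_update hl]
  rw [intervalIntegral.intervalIntegral_eq_integral_uIoc, smul_eq_mul, uIoc,
    ← integral_Icc_eq_integral_Ioc]
  simp only [signedBoxIntegral]
  rw [e1, Finset.prod_insert hl, integral_const_mul, mul_assoc]
  congr 1
  by_cases hlt : x l < c l
  · simp [hlt, not_le.2 hlt]
  · simp [hlt, not_lt.1 hlt]

theorem hybrid_update {w : Finset ι} {l : ι} (hl : l ∉ w) (x : ι → ℝ) (r : ℝ) (y : w → ℝ) :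
    hybrid (Function.update x l r) w y = Function.update (hybrid x w y) l r := by
  funext m
  by_cases hml : m = l
  · subst hml; simp [hybrid, hl]
  · by_cases hm : m ∈ w <;> simp [hybrid, hm, hml]

theorem signedBoxIntegral_empty (c x : ι → ℝ) (h : (ι → ℝ) → ℝ) :
    signedBoxIntegral ∅ c x (fun y => h (hybrid x ∅ y)) = h x := by
  have e : ∀ y, hybrid x ∅ y = x := fun y => by funext m; simp [hybrid]
  have e2 : (uIcc (fun l : (∅ : Finset ι) => c l.1) fun l => x l.1) = univ :=
    eq_univ_of_forall fun y => by
      rw [← pi_univ_uIcc, mem_univ_pi]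
      rintro ⟨m, hm⟩
      simp at hm
  simp only [signedBoxIntegral, e, e2, Finset.prod_empty, one_mul, Measure.restrict_univ,
    integral_const, smul_eq_mul]
  rw [measureReal_def, volume_pi, Measure.pi_of_empty]
  simp

end Box

/-! ### Weak mixed derivatives of the Sobol' extension -/

section Sobol

variable {ι : Type*} [Fintype ι] [DecidableEq ι]

/-- The function `1_D ∂^w g` at the hybrid point `c_{-w} : x_w`. -/
def hybridDeriv (D : Set (ι → ℝ)) (c : ι → ℝ) (F : Finset ι → (ι → ℝ) → ℝ) (w : Finset ι)
    (x : ι → ℝ) : ℝ :=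
  D.indicator (F w) (w.piecewise x c)

/-- The formal mixed derivative `∂^P` of the Sobol' extension. -/
def sobolDeriv (D : Set (ι → ℝ)) (c : ι → ℝ) (F : Finset ι → (ι → ℝ) → ℝ) (P : Finset ι)
    (x : ι → ℝ) : ℝ :=
  ∑ w ∈ Pᶜ.powerset, signedBoxIntegral w c x (fun y => hybridDeriv D c F (w ∪ P) (hybrid x w y))

variable {D : Set (ι → ℝ)} {c : ι → ℝ} {F : Finset ι → (ι → ℝ) → ℝ}

theorem hybridDeriv_update {w : Finset ι} {l : ι} (hl : l ∉ w) (x : ι → ℝ) (r : ℝ) :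
    hybridDeriv D c F w (Function.update x l r) = hybridDeriv D c F w x := by
  have e : w.piecewise (Function.update x l r) c = w.piecewise x c := by
    funext m
    by_cases hm : m ∈ w
    · have : m ≠ l := by rintro rfl; exact hl hm
      simp [hm, this]
    · simp [hm]
  rw [hybridDeriv, hybridDeriv, e]

theorem measurable_hybridDeriv (hD : IsClosed D) (hF : ∀ v, ContinuousOn (F v) D)
    (w : Finset ι) : Measurable (hybridDeriv D c F w) := by
  refine (measurable_indicator_of_continuousOn hD.measurableSet (hF w)).comp ?_
  refine measurable_pi_iff.2 fun m => ?_
  by_cases hm : m ∈ w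
  · simpa [hm] using measurable_pi_apply m
  · simp [hm]

theorem bounded_hybridDeriv (hD : IsCompact D) (hF : ∀ v, ContinuousOn (F v) D) :
    ∃ M, ∀ w x, |hybridDeriv D c F w x| ≤ M :=
  (bounded_indicator_of_continuousOn hD hF).imp fun _ hM _ _ => hM _ _

theorem sobolDeriv_sub_anchor (hD : IsCompact D) (hF : ∀ v, ContinuousOn (F v) D)
    {P : Finset ι} {l : ι} (hl : l ∉ P) (x : ι → ℝ) :
    (∀ p q, IntervalIntegrable (fun r => sobolDeriv D c F (insert l P) (Function.update x l r))
      volume p q) ∧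
    sobolDeriv D c F P x - (∑ w ∈ (insert l P)ᶜ.powerset, signedBoxIntegral w c x
      (fun y => hybridDeriv D c F (w ∪ P) (hybrid x w y))) =
      ∫ r in c l..x l, sobolDeriv D c F (insert l P) (Function.update x l r) := by
  obtain ⟨M, hM⟩ := bounded_hybridDeriv (c := c) hD hF
  have hm := measurable_hybridDeriv (c := c) hD.isClosed hF
  have hlw : ∀ w ∈ (insert l P)ᶜ.powerset, l ∉ w := fun w hw h => by
    have := Finset.mem_powerset.1 hw h
    simp at this
  have hterm : ∀ w ∈ (insert l P)ᶜ.powerset, ∀ p q, IntervalIntegrable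
      (fun r => signedBoxIntegral w c (Function.update x l r)
        (fun y => hybridDeriv D c F (w ∪ insert l P) (hybrid (Function.update x l r) w y)))
      volume p q := by
    intro w hw p q
    refine intervalIntegrable_of_bounded ((measurable_signedBoxIntegral w c
      (hm (w ∪ insert l P))).comp (measurable_update x)) (M := M * ∏ m ∈ w, |x m - c m|) ?_ p q
    intro r
    simp only [Function.comp, signedBoxIntegral_update (hlw w hw)]
    exact abs_signedBoxIntegral_le w c x _ fun y => hM _ _
  refine ⟨fun p q => ?_, ?_⟩
  · have := IntervalIntegrable.sum _ fun w hw => hterm w hw p q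
    simp only [Finset.sum_fn] at this
    exact this
  simp only [sobolDeriv]
  rw [intervalIntegral.integral_finsetSum fun w hw => hterm w hw _ _]
  have e : Pᶜ = insert l (insert l P)ᶜ := by
    ext m
    by_cases h : m = l
    · subst h; simp [hl]
    · simp [h]
  rw [e, Finset.sum_powerset_insert (by simp), add_sub_cancel_left]
  refine Finset.sum_congr rfl fun w hw => ?_
  have e2 : insert l w ∪ P = w ∪ insert l P := by
    rw [Finset.insert_union, Finset.union_insert]
  rw [e2, signedBoxIntegral_insert (hlw w hw) c x (hm _) ⟨M, hM _⟩]

theorem sobolDeriv_sub (hD : IsCompact D) (hF : ∀ v, ContinuousOn (F v) D)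
    {P : Finset ι} {l : ι} (hl : l ∉ P) (x : ι → ℝ) (z : ℝ) :
    sobolDeriv D c F P x - sobolDeriv D c F P (Function.update x l z) =
      ∫ r in z..x l, sobolDeriv D c F (insert l P) (Function.update x l r) := by
  obtain ⟨hi, h1⟩ := sobolDeriv_sub_anchor (c := c) hD hF hl x
  obtain ⟨-, h2⟩ := sobolDeriv_sub_anchor (c := c) hD hF hl (Function.update x l z)
  simp only [Function.update_idem, Function.update_self] at h2
  have e : ∑ w ∈ (insert l P)ᶜ.powerset, signedBoxIntegral w c (Function.update x l z)
      (fun y => hybridDeriv D c F (w ∪ P) (hybrid (Function.update x l z) w y)) =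
      ∑ w ∈ (insert l P)ᶜ.powerset, signedBoxIntegral w c x
      (fun y => hybridDeriv D c F (w ∪ P) (hybrid x w y)) := by
    refine Finset.sum_congr rfl fun w hw => ?_
    have hlw : l ∉ w := fun h => by
      have := Finset.mem_powerset.1 hw h
      simp at this
    rw [signedBoxIntegral_update hlw]
    congr 1
    funext y
    rw [hybrid_update hlw, hybridDeriv_update]
    simp [hlw, hl]
  rw [e] at h2
  rw [← intervalIntegral.integral_interval_sub_left (hi (c l) (x l)) (hi (c l) z), ← h1, ← h2]
  ring

theorem sobolDeriv_weakMixedFamily (hD : IsCompact D) (hF : ∀ v, ContinuousOn (F v) D)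
    {p q : ι → ℝ} (hc : c ∈ Icc p q) :
    WeakMixedFamily p q (fun P => (Icc p q).indicator (sobolDeriv D c F P)) := by
  obtain ⟨M, hM⟩ := bounded_hybridDeriv (c := c) hD hF
  have hM0 : 0 ≤ M := (abs_nonneg _).trans (hM ∅ c)
  have hpq : ∀ m, 0 ≤ q m - p m := fun m => sub_nonneg.2 ((hc.1 m).trans (hc.2 m))
  have hN : ∀ w : Finset ι, 0 ≤ M * ∏ m ∈ w, (q m - p m) := fun w =>
    mul_nonneg hM0 (Finset.prod_nonneg fun m _ => hpq m)
  refine ⟨fun P => ?_, ⟨∑ w : Finset ι, M * ∏ m ∈ w, (q m - p m), fun P x => ?_⟩,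
    fun P x hx => indicator_of_notMem hx _, fun P l hl x hx z hz => ?_⟩
  · refine Measurable.indicator ?_ measurableSet_Icc
    exact Finset.measurable_fun_sum _ fun w _ => measurable_signedBoxIntegral w c
      (measurable_hybridDeriv hD.isClosed hF _)
  · by_cases hx : x ∈ Icc p q
    · rw [indicator_of_mem hx, sobolDeriv]
      refine (Finset.abs_sum_le_sum_abs _ _).trans ?_
      refine (Finset.sum_le_sum fun w _ => ?_).trans
        (Finset.sum_le_sum_of_subset_of_nonneg (Finset.subset_univ _) fun w _ _ => hN w)
      refine (abs_signedBoxIntegral_le w c x _ fun y => hM _ _).trans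
        (mul_le_mul_of_nonneg_left ?_ hM0)
      refine Finset.prod_le_prod (fun _ _ => abs_nonneg _) fun m _ => ?_
      rw [abs_le]
      have := hx.1 m; have := hx.2 m; have := hc.1 m; have := hc.2 m
      constructor <;> linarith
    · rw [indicator_of_notMem hx, abs_zero]
      exact Finset.sum_nonneg fun w _ => hN w
  · rw [indicator_of_mem hx, indicator_of_mem (update_mem_Icc hx hz), sobolDeriv_sub hD hF hl]
    refine intervalIntegral.integral_congr fun r hr => (indicator_of_mem ?_ _).symm
    exact update_mem_Icc hx (uIcc_subset_Icc hz ⟨hx.1 l, hx.2 l⟩ hr)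

theorem piecewise_anchor_mem (hS : IsSobolExtensible D c) {x : ι → ℝ} (hx : x ∈ D)
    (T : Finset ι) : T.piecewise c x ∈ D := by
  refine hS.box_subset x hx ?_
  rw [← pi_univ_uIcc, mem_univ_pi]
  intro m
  by_cases hm : m ∈ T <;> simp [hm]

theorem sobolDeriv_eq (hS : IsSobolExtensible D c) (hD : IsCompact D)
    (hF : ∀ v, ContinuousOn (F v) D)
    (hFd : ∀ v, ∀ l ∉ v, ∀ x ∈ D, HasPartialWithinAt D (F v) l x (F (insert l v) x))
    (P : Finset ι) : ∀ x ∈ D, sobolDeriv D c F P x = F P x := by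
  obtain ⟨M, hM⟩ := bounded_hybridDeriv (c := c) hD hF
  induction hn : Pᶜ.card using Nat.strong_induction_on generalizing P with
  | _ n ih =>
    intro x hx
    have step : ∀ T : Finset ι, Disjoint T P → sobolDeriv D c F P x - F P x =
        sobolDeriv D c F P (T.piecewise c x) - F P (T.piecewise c x) := by
      intro T
      induction T using Finset.induction_on with
      | empty => simp
      | insert l T hl ihT =>
        intro hTP
        rw [Finset.disjoint_insert_left] at hTP
        rw [ihT hTP.2, Finset.piecewise_insert]
        have hxT := piecewise_anchor_mem hS hx T
        generalize T.piecewise c x = x' at hxT ⊢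
        have h1 := sobolDeriv_sub (c := c) hD hF hTP.1 x' (c l)
        have h2 := partial_sub_eq (fun r hr => hS.update_mem hxT hr) (hF _) (hFd P l hTP.1)
        have h3 : ∫ r in c l..x' l, sobolDeriv D c F (insert l P) (Function.update x' l r) =
            ∫ r in c l..x' l, F (insert l P) (Function.update x' l r) := by
          refine intervalIntegral.integral_congr fun r hr => ?_
          refine ih _ ?_ (insert l P) rfl _ (hS.update_mem hxT hr)
          rw [← hn]
          refine Finset.card_lt_card ?_
          rw [Finset.compl_ssubset_compl]
          exact Finset.ssubset_insert hTP.1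
        rw [h3, ← h2] at h1
        linarith
    have h1 := step Pᶜ disjoint_compl_left
    have hx' := piecewise_anchor_mem hS hx Pᶜ
    have h2 : sobolDeriv D c F P (Pᶜ.piecewise c x) = F P (Pᶜ.piecewise c x) := by
      rw [sobolDeriv, Finset.sum_eq_single ∅]
      · rw [signedBoxIntegral_empty, hybridDeriv, Finset.empty_union]
        have e : P.piecewise (Pᶜ.piecewise c x) c = Pᶜ.piecewise c x := by
          funext m
          by_cases hm : m ∈ P <;> simp [hm]
        rw [e, indicator_of_mem hx']
      · intro w hw hne
        obtain ⟨l, hl⟩ := Finset.nonempty_iff_ne_empty.2 hne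
        have h3 := abs_signedBoxIntegral_le w c (Pᶜ.piecewise c x)
          (fun y => hybridDeriv D c F (w ∪ P) (hybrid (Pᶜ.piecewise c x) w y)) fun y => hM _ _
        rw [Finset.prod_eq_zero hl, mul_zero] at h3
        · exact abs_nonpos_iff.1 h3
        · have : l ∈ Pᶜ := Finset.mem_powerset.1 hw hl
          rw [Finset.piecewise_eq_of_mem _ _ _ this, sub_self, abs_zero]
      · intro h
        exact (h (Finset.empty_mem_powerset _)).elim
    rw [h2, sub_self] at h1
    exact sub_eq_zero.1 h1

end Sobol

section SobolBound

variable {s d b : ℕ}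

theorem sobolExtension_eq {D : Set (Fin s × Fin d → ℝ)} {c : Fin s × Fin d → ℝ}
    (hS : IsSobolExtensible D c) {g : (Fin s × Fin d → ℝ) → ℝ}
    {F : Finset (Fin s × Fin d) → (Fin s × Fin d → ℝ) → ℝ} (hF0 : EqOn (F ∅) g D)
    (hFd : ∀ v, ∀ l ∉ v, ∀ x ∈ D, HasPartialWithinAt D (F v) l x (F (insert l v) x)) :
    sobolExtension D c g = sobolDeriv D c F ∅ := by
  funext x
  rw [sobolExtension, sobolDeriv, Finset.compl_empty, Finset.powerset_univ]
  refine Finset.sum_congr rfl fun w _ => ?_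
  rw [signedBoxIntegral, signedBoxIntegral]
  congr 1
  refine integral_congr_ae (ae_restrict_of_ae ?_)
  have hne : ∀ᵐ y : w → ℝ, ∀ l : w, y l ≠ c l := by
    rw [ae_all_iff]
    exact fun l => Measure.ae_eval_ne (μ := fun _ : w => (volume : Measure ℝ)) l (c l)
  filter_upwards [hne] with y hy
  have e : (w ∪ ∅).piecewise (hybrid x w y) c = hybrid c w y := by
    funext m
    by_cases hm : m ∈ w <;> simp [hybrid, hm]
  rw [hybridDeriv, e, Finset.union_empty]
  by_cases hD : hybrid c w y ∈ D
  · rw [indicator_of_mem hD, indicator_of_mem hD, hS.mixedPartial_eq hF0 hFd w hD]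
    intro l hl
    simpa [hybrid, hl] using hy ⟨l, hl⟩
  · rw [indicator_of_notMem hD, indicator_of_notMem hD]

theorem coefficient_le_sobol (hd : 0 < d) (hb : 2 ≤ b)
    {X : Fin s → Set (EuclideanSpace ℝ (Fin d))}
    (hXb : ∀ j, Bornology.IsBounded (X j)) (hXv : ∀ j, volume (X j) = 1)
    (S : ∀ j, RecursiveSplit b (X j)) {C : ℝ} (hC : 1 ≤ C)
    (hdiam : ∀ j k t, t < b ^ k →
      Metric.diam ((S j).cell k t) ≤ C * (b : ℝ) ^ (-((k : ℝ) / (d : ℝ))))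
    (f : (Fin s × Fin d → ℝ) → ℝ) (u : Finset (Fin s)) (κ : u → ℕ)
    (τ : ∀ j : u, Fin (b ^ κ j)) (γ : u → Fin b) {c : Fin s × Fin d → ℝ}
    (hS : IsSobolExtensible (prodSet X) c) (hf : SmoothOn (prodSet X) f) :
    ENNReal.ofReal |innerProd X f (multiHaar S u κ τ γ)| ≤
      coefficientBound S C u κ τ (sobolExtension (prodSet X) c (anova X f u)) := by
  have hXm := measurableSet_region S
  have hK := isCompact_prodSet hXb hS.isClosed
  have hfi : IntegrableOn f (prodSet X) := by
    obtain ⟨F, hF0, hFc, -⟩ := hf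
    exact ((hFc ∅).congr hF0.symm).integrableOn_compact hK
  obtain ⟨F, hF0, hFc, hFd⟩ := hf.anova hXm hXb hXv hS u
  obtain ⟨p, q, hpq⟩ : ∃ p q, rectHull (prodSet X) = Icc p q := ⟨_, _, rectHull_eq_Icc _⟩
  have hsub := subset_rectHull (isBounded_prodSet hXb)
  rw [sobolExtension_eq hS hF0 hFd]
  have hfam := sobolDeriv_weakMixedFamily (F := F) hK hFc (hpq ▸ hsub hS.anchor_mem)
  have heF : EqOn (sobolDeriv (prodSet X) c F ∅)
      ((Icc p q).indicator (sobolDeriv (prodSet X) c F ∅)) (rectHull (prodSet X)) :=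
    fun x hx => (indicator_of_mem (hpq ▸ hx) _).symm
  have key := hfam.coefficient_le S u κ τ γ hd hb hXm hXb hXv hC hdiam hpq heF
  rw [← innerProd_anova S u κ τ γ hb hXm hXv hfi, innerProd]
  convert key using 3
  refine setIntegral_congr_fun (measurableSet_prodSet hXm) fun x hx => ?_
  simp only [← heF (hsub hx), sobolDeriv_eq hS hK hFc hFd ∅ x hx, hF0 hx]

end SobolBound

end

theorem mainTheorem5 (s d b : ℕ) (hd : 0 < d) (hb : 2 ≤ b)
    (X : Fin s → Set (EuclideanSpace ℝ (Fin d)))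
    (hXb : ∀ j, Bornology.IsBounded (X j)) (hXv : ∀ j, volume (X j) = 1)
    (S : ∀ j, RecursiveSplit b (X j)) (C : ℝ) (hC : 1 ≤ C)
    (hdiam : ∀ j k t, t < b ^ k →
      Metric.diam ((S j).cell k t) ≤ C * (b : ℝ) ^ (-((k : ℝ) / (d : ℝ))))
    (f : (Fin s × Fin d → ℝ) → ℝ) (u : Finset (Fin s)) (κ : u → ℕ)
    (τ : ∀ j : u, Fin (b ^ κ j)) (γ : u → Fin b) :
    (∀ c, IsSobolExtensible (prodSet X) c → SmoothOn (prodSet X) f →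
      ENNReal.ofReal |innerProd X f (multiHaar S u κ τ γ)| ≤
        coefficientBound S C u κ τ (sobolExtension (prodSet X) c (anova X f u))) ∧
    ((∀ j, IsClosed (X j) ∧ (interior (X j)).Nonempty ∧ volume (frontier (X j)) = 0) →
      InCm (prodSet X) (d * s) f →
      ∀ e, IsWhitneyExtension (prodSet X) (d * s) (anova X f u) e →
        ENNReal.ofReal |innerProd X f (multiHaar S u κ τ γ)| ≤
          coefficientBound S C u κ τ e) := by
  exact ⟨fun c hc hf => coefficient_le_sobol hd hb hXb hXv S hC hdiam f u κ τ γ hc hf,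
    fun hX hf e he => coefficient_le_whitney hd hb hXb hXv S hC hdiam f u κ τ γ
      (fun j => (hX j).1) hf e he⟩
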